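/- Let $\mathbf{vNA}_{\mathrm{MIU}}$ be the category whose objects are von Neumann algebras $\mathscr A$ (each acting on a Hilbert space $\mathscr H_{\mathscr A}$) and whose morphisms are the normal MIU-maps, that is, the unital $*$-homomorphisms that preserve suprema of bounded directed sets of self-adjoint elements (where $a\le b$ iff $b-a=c^*c$ for some $c$). Let $\mathscr A\otimes\mathscr B$ be the spatial tensor product, that is, the least von Neumann algebra on the Hilbert space tensor product $\mathscr H_{\mathscr A}\otimes\mathscr H_{\mathscr B}$ containing all operators $a\otimes b$ with $a\in\mathscr A$, $b\in\mathscr B$. Then $(\mathbf{vNA}_{\mathrm{MIU}},\otimes,\mathbb C)$ is a symmetric monoidal category, with $(f\otimes g)(a\otimes b)=f(a)\otimes g(b)$, and with associator, unitors and symmetry given by $(a\otimes b)\otimes c\mapsto a\otimes(b\otimes c)$, $z\otimes a\mapsto za$, $a\otimes z\mapsto za$ and $a\otimes b\mapsto b\otimes a$. Let $\mathbf{Set}^{\mathrm{op}}$ be symmetric monoidal via the cartesian product $\times$ of sets and the one-point set $1$. For a set $X$ let $\ell^\infty(X)$ be the von Neumann algebra of bounded maps $X\to\mathbb C$, and let $\ell^\infty\colon\mathbf{Set}^{\mathrm{op}}\to\mathbf{vNA}_{\mathrm{MIU}}$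 be the functor with $\ell^\infty(g)(\varphi)=\varphi\circ g$. For a von Neumann algebra $\mathscr A$ let $\mathrm{nsp}(\mathscr A)$ be the set of normal MIU-maps $\mathscr A\to\mathbb C$, and let $\mathrm{nsp}\colon\mathbf{vNA}_{\mathrm{MIU}}\to\mathbf{Set}^{\mathrm{op}}$ be the functor with $\mathrm{nsp}(f)(\omega)=\omega\circ f$. There is an adjunction $\mathrm{nsp}\dashv\ell^\infty$ in which a normal MIU-map $f\colon\mathscr A\to\ell^\infty(X)$ corresponds to the map $g\colon X\to\mathrm{nsp}(\mathscr A)$ with $g(x)(a)=f(a)(x)$. This adjunction between $(\mathbf{Set}^{\mathrm{op}},\times,1)$ and $(\mathbf{vNA}_{\mathrm{MIU}},\otimes,\mathbb C)$ is strong symmetric monoidal: the functors $\mathrm{nsp}$ and $\ell^\infty$ carry structures of strong symmetric monoidal functors for which the unit and the counit of the adjunction are monoidal natural transformations. The structure isomorphisms can be chosen to be the canonical ones: $\mathrm{nsp}(\mathscr A)\times\mathrm{nsp}(\mathscr B)\cong\mathrm{nsp}(\mathscr A\otimes\mathscr B)$ sends $(\omega_1,\omega_2)$ to the $\omega$ with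 $\omega(a\otimes b)=\omega_1(a)\,\omega_2(b)$, and $\ell^\infty(X)\otimes\ell^\infty(Y)\cong\ell^\infty(X\times Y)$ sends $f\otimes g$ to $(x,y)\mapsto f(x)\,g(y)$. -/

import Mathlib

open CategoryTheory MonoidalCategory Opposite
open scoped TensorProduct ENNReal

universe u

noncomputable section

/-! ### The order on self-adjoint elements, suprema and normal maps -/

/-- `a ≤ b` in the order of a `*`-algebra: `b - a` is positive, i.e. of the form `c* c`. -/
def StarLE {R : Type*} [Ring R] [StarRing R] (a b : R) : Prop :=
  ∃ c : R, b - a = star c * c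

/-- `s` is the supremum of `D` in the set of self-adjoint elements. -/
structure IsSelfAdjointSup {R : Type*} [Ring R] [StarRing R] (D : Set R) (s : R) : Prop where
  isSelfAdjoint : IsSelfAdjoint s
  upper : ∀ d ∈ D, StarLE d s
  least : ∀ t, IsSelfAdjoint t → (∀ d ∈ D, StarLE d t) → StarLE s t

/-- A unital `*`-homomorphism (MIU-map) is normal if it preserves the suprema of directed sets of
self-adjoint elements. (A directed set with a supremum is bounded, and in a von Neumann algebra
every bounded directed set has a supremum; MIU-maps are automatically positive.) -/
def IsNormalMap {R S : Type*} [Ring R] [StarRing R] [Algebra ℂ R]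
    [Ring S] [StarRing S] [Algebra ℂ S] (f : R →⋆ₐ[ℂ] S) : Prop :=
  ∀ (D : Set R) (s : R), D.Nonempty → (∀ d ∈ D, IsSelfAdjoint d) → DirectedOn StarLE D →
    IsSelfAdjointSup D s → IsSelfAdjointSup (f '' D) (f s)

section normal

variable {R S T : Type*} [Ring R] [StarRing R] [Algebra ℂ R]
  [Ring S] [StarRing S] [Algebra ℂ S] [Ring T] [StarRing T] [Algebra ℂ T]

theorem StarLE.map (f : R →⋆ₐ[ℂ] S) {a b : R} (h : StarLE a b) : StarLE (f a) (f b) := by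
  obtain ⟨c, hc⟩ := h
  exact ⟨f c, by rw [← map_sub, hc, map_mul, map_star]⟩

theorem isNormalMap_id : IsNormalMap (StarAlgHom.id ℂ R) := by
  intro D s _ _ _ h
  simpa using h

theorem IsNormalMap.comp {g : S →⋆ₐ[ℂ] T} {f : R →⋆ₐ[ℂ] S}
    (hg : IsNormalMap g) (hf : IsNormalMap f) : IsNormalMap (g.comp f) := by
  intro D s hD hsa hdir hs
  have h := hg (f '' D) (f s) (hD.image f)
    (by rintro _ ⟨d, hd, rfl⟩; exact (hsa d hd).map f)
    (by
      rintro _ ⟨a, ha, rfl⟩ _ ⟨b, hb, rfl⟩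
      obtain ⟨c, hc, hac, hbc⟩ := hdir a ha b hb
      exact ⟨f c, ⟨c, hc, rfl⟩, hac.map f, hbc.map f⟩)
    (hf D s hD hsa hdir hs)
  rw [Set.image_image] at h
  exact h

theorem IsSelfAdjointSup.map_equiv (e : R ≃⋆ₐ[ℂ] S) {D : Set R} {s : R}
    (h : IsSelfAdjointSup D s) : IsSelfAdjointSup (e '' D) (e s) where
  isSelfAdjoint := h.isSelfAdjoint.map e
  upper := by
    rintro _ ⟨d, hd, rfl⟩
    exact (h.upper d hd).map (e : R →⋆ₐ[ℂ] S)
  least t ht hub := by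
    have := h.least (e.symm t) (ht.map e.symm) (fun d hd => by
      simpa using (hub (e d) ⟨d, hd, rfl⟩).map (e.symm : S →⋆ₐ[ℂ] R))
    simpa using this.map (e : R →⋆ₐ[ℂ] S)

theorem isNormalMap_equiv (e : R ≃⋆ₐ[ℂ] S) : IsNormalMap (e : R →⋆ₐ[ℂ] S) :=
  fun _ _ _ _ _ h => h.map_equiv e

end normal

/-! ### The category of von Neumann algebras and normal MIU-maps -/

/-- A von Neumann algebra together with the Hilbert space on which it acts. -/
structure VNAlg : Type (u + 1) where
  H : Type u
  [normedAddCommGroup : NormedAddCommGroup H]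
  [innerProductSpace : InnerProductSpace ℂ H]
  [completeSpace : CompleteSpace H]
  algebra : VonNeumannAlgebra H

namespace VNAlg

attribute [instance] normedAddCommGroup innerProductSpace completeSpace

/-- The elements of a von Neumann algebra, as a `*`-algebra. -/
abbrev Elt (A : VNAlg.{u}) : Type u := A.algebra.toStarSubalgebra

instance (A : VNAlg.{u}) : CompleteSpace A.Elt := by
  have h : IsClosed (A.algebra.toStarSubalgebra : Set (A.H →L[ℂ] A.H)) := by
    have := A.algebra.centralizer_centralizer'
    change IsClosed A.algebra.carrier
    rw [← this]
    exact Set.isClosed_centralizer _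
  exact h.completeSpace_coe

instance (A : VNAlg.{u}) : CStarAlgebra A.Elt where

/-- Normal MIU-maps. -/
@[ext]
structure Hom (A B : VNAlg.{u}) where
  toStarAlgHom : A.Elt →⋆ₐ[ℂ] B.Elt
  normal : IsNormalMap toStarAlgHom

instance : Category VNAlg.{u} where
  Hom A B := Hom A B
  id A := ⟨StarAlgHom.id ℂ A.Elt, isNormalMap_id⟩
  comp f g := ⟨g.toStarAlgHom.comp f.toStarAlgHom, g.normal.comp f.normal⟩

/-- The map of elements underlying a morphism. -/
def ap {A B : VNAlg.{u}} (f : A ⟶ B) : A.Elt →⋆ₐ[ℂ] B.Elt := Hom.toStarAlgHom f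

theorem hom_ext {A B : VNAlg.{u}} {f g : A ⟶ B} (h : ∀ a, ap f a = ap g a) : f = g :=
  Hom.ext (StarAlgHom.ext h)

@[simp] theorem ap_comp {A B C : VNAlg.{u}} (f : A ⟶ B) (g : B ⟶ C) (a : A.Elt) :
    ap (f ≫ g) a = ap g (ap f a) := rfl

@[simp] theorem ap_id {A : VNAlg.{u}} (a : A.Elt) : ap (𝟙 A) a = a := rfl

/-! ### The spatial tensor product -/

/-- The least von Neumann algebra on `H` which contains `s`. -/
def generated {H : Type u} [NormedAddCommGroup H] [InnerProductSpace ℂ H] [CompleteSpace H]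
    (s : Set (H →L[ℂ] H)) : VonNeumannAlgebra H where
  toStarSubalgebra :=
    StarSubalgebra.centralizer ℂ (StarSubalgebra.centralizer ℂ s : Set (H →L[ℂ] H))
  centralizer_centralizer' := by
    change Set.centralizer (Set.centralizer
      ((StarSubalgebra.centralizer ℂ (StarSubalgebra.centralizer ℂ s : Set (H →L[ℂ] H)) :
        StarSubalgebra ℂ (H →L[ℂ] H)) : Set (H →L[ℂ] H))) =
      ((StarSubalgebra.centralizer ℂ (StarSubalgebra.centralizer ℂ s : Set (H →L[ℂ] H)) :
        StarSubalgebra ℂ (H →L[ℂ] H)) : Set (H →L[ℂ] H))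
    rw [StarSubalgebra.coe_centralizer_centralizer, Set.centralizer_centralizer_centralizer]

theorem subset_generated {H : Type u} [NormedAddCommGroup H] [InnerProductSpace ℂ H]
    [CompleteSpace H] (s : Set (H →L[ℂ] H)) : s ⊆ (generated s : Set (H →L[ℂ] H)) := by
  change s ⊆ ((StarSubalgebra.centralizer ℂ (StarSubalgebra.centralizer ℂ s : Set (H →L[ℂ] H)) :
        StarSubalgebra ℂ (H →L[ℂ] H)) : Set (H →L[ℂ] H))
  rw [StarSubalgebra.coe_centralizer_centralizer]
  exact Set.subset_union_left.trans Set.subset_centralizer_centralizer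

theorem generated_le {H : Type u} [NormedAddCommGroup H] [InnerProductSpace ℂ H]
    [CompleteSpace H] {s : Set (H →L[ℂ] H)} {M : VonNeumannAlgebra H}
    (h : s ⊆ (M : Set (H →L[ℂ] H))) : generated s ≤ M := by
  change ((StarSubalgebra.centralizer ℂ (StarSubalgebra.centralizer ℂ s : Set (H →L[ℂ] H)) :
        StarSubalgebra ℂ (H →L[ℂ] H)) : Set (H →L[ℂ] H)) ⊆ (M : Set (H →L[ℂ] H))
  rw [StarSubalgebra.coe_centralizer_centralizer, ← M.centralizer_centralizer]
  refine Set.centralizer_subset (Set.centralizer_subset (Set.union_subset h ?_))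
  intro x hx
  simpa using star_mem (show star x ∈ M from h hx)

/-- The spatial tensor product: the von Neumann algebra on the Hilbert space tensor product
(the completion of the algebraic one) generated by the operators `a ⊗ b`. -/
def tensor (A B : VNAlg.{u}) : VNAlg.{u} where
  H := UniformSpace.Completion (A.H ⊗[ℂ] B.H)
  algebra := generated
    {t | ∃ a ∈ A.algebra, ∃ b ∈ B.algebra, t = (TensorProduct.mapL a b).completion}

/-- The element `a ⊗ b` of the spatial tensor product, the operator with
`(a ⊗ b) (x ⊗ y) = a x ⊗ b y`. -/
def tmul {A B : VNAlg.{u}} (a : A.Elt) (b : B.Elt) : (tensor A B).Elt :=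
  ⟨(TensorProduct.mapL a.1 b.1).completion, subset_generated _ ⟨a.1, a.2, b.1, b.2, rfl⟩⟩

theorem tmul_apply {A B : VNAlg.{u}} (a : A.Elt) (b : B.Elt) (x : A.H) (y : B.H) :
    (tmul a b).1 ((x ⊗ₜ[ℂ] y : A.H ⊗[ℂ] B.H) : UniformSpace.Completion (A.H ⊗[ℂ] B.H)) =
      ((a.1 x ⊗ₜ[ℂ] b.1 y : A.H ⊗[ℂ] B.H) : UniformSpace.Completion (A.H ⊗[ℂ] B.H)) :=
  ContinuousLinearMap.completion_apply_coe _ _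

/-- The von Neumann algebra `ℂ`, i.e. all operators on a one-dimensional Hilbert space. -/
def unit : VNAlg.{u} where
  H := EuclideanSpace ℂ PUnit.{u + 1}
  algebra :=
    { toStarSubalgebra := ⊤
      centralizer_centralizer' := by
        change Set.centralizer (Set.centralizer Set.univ) = Set.univ
        refine Set.eq_univ_of_forall (fun x y hy => ?_)
        exact (hy x (Set.mem_univ x)).symm }

/-- The symmetric monoidal structure `(⊗, ℂ)` on von Neumann algebras and normal MIU-maps. All
data are determined by their values on the operators `a ⊗ b`. -/
structure SpatialTensorData where
  /-- `f ⊗ g` -/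
  map {A B C D : VNAlg.{u}} (f : A ⟶ C) (g : B ⟶ D) : tensor A B ⟶ tensor C D
  map_tmul {A B C D : VNAlg.{u}} (f : A ⟶ C) (g : B ⟶ D) (a : A.Elt) (b : B.Elt) :
    ap (map f g) (tmul a b) = tmul (ap f a) (ap g b)
  assoc (A B C : VNAlg.{u}) : tensor (tensor A B) C ≅ tensor A (tensor B C)
  assoc_tmul {A B C : VNAlg.{u}} (a : A.Elt) (b : B.Elt) (c : C.Elt) :
    ap (assoc A B C).hom (tmul (tmul a b) c) = tmul a (tmul b c)
  lid (A : VNAlg.{u}) : tensor unit A ≅ A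
  lid_tmul {A : VNAlg.{u}} (z : ℂ) (a : A.Elt) :
    ap (lid A).hom (tmul (algebraMap ℂ unit.Elt z) a) = z • a
  rid (A : VNAlg.{u}) : tensor A unit ≅ A
  rid_tmul {A : VNAlg.{u}} (a : A.Elt) (z : ℂ) :
    ap (rid A).hom (tmul a (algebraMap ℂ unit.Elt z)) = z • a
  braid (A B : VNAlg.{u}) : tensor A B ≅ tensor B A
  braid_tmul {A B : VNAlg.{u}} (a : A.Elt) (b : B.Elt) :
    ap (braid A B).hom (tmul a b) = tmul b a

/-- The data together with the axioms of a symmetric monoidal category. -/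
structure SpatialTensor extends SpatialTensorData.{u} where
  map_id (A B : VNAlg.{u}) : map (𝟙 A) (𝟙 B) = 𝟙 (tensor A B)
  map_comp {A₁ B₁ C₁ A₂ B₂ C₂ : VNAlg.{u}} (f₁ : A₁ ⟶ B₁) (f₂ : A₂ ⟶ B₂)
    (g₁ : B₁ ⟶ C₁) (g₂ : B₂ ⟶ C₂) : map f₁ f₂ ≫ map g₁ g₂ = map (f₁ ≫ g₁) (f₂ ≫ g₂)
  assoc_naturality {A₁ A₂ A₃ B₁ B₂ B₃ : VNAlg.{u}}
    (f₁ : A₁ ⟶ B₁) (f₂ : A₂ ⟶ B₂) (f₃ : A₃ ⟶ B₃) :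
    map (map f₁ f₂) f₃ ≫ (assoc B₁ B₂ B₃).hom = (assoc A₁ A₂ A₃).hom ≫ map f₁ (map f₂ f₃)
  lid_naturality {A B : VNAlg.{u}} (f : A ⟶ B) :
    map (𝟙 unit) f ≫ (lid B).hom = (lid A).hom ≫ f
  rid_naturality {A B : VNAlg.{u}} (f : A ⟶ B) :
    map f (𝟙 unit) ≫ (rid B).hom = (rid A).hom ≫ f
  pentagon (A B C D : VNAlg.{u}) :
    map (assoc A B C).hom (𝟙 D) ≫ (assoc A (tensor B C) D).hom ≫ map (𝟙 A) (assoc B C D).hom =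
      (assoc (tensor A B) C D).hom ≫ (assoc A B (tensor C D)).hom
  triangle (A B : VNAlg.{u}) :
    (assoc A unit B).hom ≫ map (𝟙 A) (lid B).hom = map (rid A).hom (𝟙 B)
  braid_naturality {A₁ A₂ B₁ B₂ : VNAlg.{u}} (f : A₁ ⟶ B₁) (g : A₂ ⟶ B₂) :
    map f g ≫ (braid B₁ B₂).hom = (braid A₁ A₂).hom ≫ map g f
  hexagon_forward (A B C : VNAlg.{u}) :
    (assoc A B C).hom ≫ (braid A (tensor B C)).hom ≫ (assoc B C A).hom =
      map (braid A B).hom (𝟙 C) ≫ (assoc B A C).hom ≫ map (𝟙 B) (braid A C).hom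
  hexagon_reverse (A B C : VNAlg.{u}) :
    (assoc A B C).inv ≫ (braid (tensor A B) C).hom ≫ (assoc C A B).inv =
      map (𝟙 A) (braid B C).hom ≫ (assoc A C B).inv ≫ map (braid A C).hom (𝟙 B)
  symmetry (A B : VNAlg.{u}) : (braid A B).hom ≫ (braid B A).hom = 𝟙 (tensor A B)

/-- The monoidal category `(vNA, ⊗, ℂ)`. -/
abbrev SpatialTensor.monoidalCategory (T : SpatialTensor.{u}) : MonoidalCategory VNAlg.{u} :=
  letI : MonoidalCategoryStruct VNAlg.{u} :=
    { tensorObj := tensor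
      tensorUnit := unit
      tensorHom := T.map
      whiskerLeft := fun A _ _ g => T.map (𝟙 A) g
      whiskerRight := fun f B => T.map f (𝟙 B)
      associator := T.assoc
      leftUnitor := T.lid
      rightUnitor := T.rid }
  MonoidalCategory.ofTensorHom
    (id_tensorHom_id := T.map_id)
    (id_tensorHom := fun _ _ _ _ => rfl)
    (tensorHom_id := fun _ _ => rfl)
    (tensorHom_comp_tensorHom := T.map_comp)
    (associator_naturality := T.assoc_naturality)
    (leftUnitor_naturality := T.lid_naturality)
    (rightUnitor_naturality := T.rid_naturality)
    (pentagon := T.pentagon)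
    (triangle := T.triangle)

/-- The symmetry of `(vNA, ⊗, ℂ)`. -/
abbrev SpatialTensor.symmetricCategory (T : SpatialTensor.{u}) :
    @SymmetricCategory VNAlg.{u} _ T.monoidalCategory :=
  letI := T.monoidalCategory
  { braiding := T.braid
    braiding_naturality_right := fun _ _ _ g => T.braid_naturality (𝟙 _) g
    braiding_naturality_left := fun f _ => T.braid_naturality f (𝟙 _)
    hexagon_forward := T.hexagon_forward
    hexagon_reverse := T.hexagon_reverse
    symmetry := T.symmetry }

end VNAlg

/-! ### The von Neumann algebra of bounded functions on a set -/

/-- The `*`-algebra of bounded maps `X → ℂ`. -/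
abbrev BddFun (X : Type u) : Type u := lp (fun _ : X => ℂ) ∞

/-- The Hilbert space of square-summable maps `X → ℂ`. -/
abbrev EllTwo (X : Type u) : Type u := lp (fun _ : X => ℂ) 2

theorem memℓp_mul {X : Type u} (φ : BddFun X) (f : EllTwo X) :
    Memℓp (fun x => φ x * f x) 2 := by
  refine Memℓp.mono' ((lp.memℓp f).const_smul (‖φ‖ : ℂ)) (fun x => ?_)
  have := lp.norm_apply_le_norm ENNReal.top_ne_zero φ x
  change ‖φ x * f x‖ ≤ ‖(‖φ‖ : ℂ) * f x‖
  simpa using mul_le_mul_of_nonneg_right this (norm_nonneg (f x))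

/-- The operator of multiplication with a bounded function. -/
def mulOp {X : Type u} (φ : BddFun X) : EllTwo X →L[ℂ] EllTwo X :=
  LinearMap.mkContinuous
    { toFun := fun f => ⟨fun x => φ x * f x, memℓp_mul φ f⟩
      map_add' := fun f g => by
        apply lp.ext; funext x
        exact mul_add _ _ _
      map_smul' := fun c f => by
        apply lp.ext; funext x
        exact mul_left_comm _ _ _ } ‖φ‖
    (fun f => by
      have : ‖((‖φ‖ : ℂ) • f : EllTwo X)‖ = ‖φ‖ * ‖f‖ := by
        rw [norm_smul]; simp
      rw [← this]
      refine lp.norm_mono (by simp) (fun x => ?_)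
      have := lp.norm_apply_le_norm ENNReal.top_ne_zero φ x
      change ‖φ x * f x‖ ≤ ‖(‖φ‖ : ℂ) * f x‖
      simpa using mul_le_mul_of_nonneg_right this (norm_nonneg (f x)))

@[simp] theorem mulOp_apply {X : Type u} (φ : BddFun X) (f : EllTwo X) (x : X) :
    mulOp φ f x = φ x * f x := rfl

theorem ellTwo_ext {X : Type u} {f g : EllTwo X} (h : ∀ x, f x = g x) : f = g :=
  lp.ext (funext h)

theorem mulOp_adjoint {X : Type u} (φ : BddFun X) : mulOp (star φ) = star (mulOp φ) := by
  rw [ContinuousLinearMap.star_eq_adjoint, ContinuousLinearMap.eq_adjoint_iff]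
  intro f g
  rw [lp.inner_eq_tsum, lp.inner_eq_tsum]
  refine tsum_congr (fun x => ?_)
  simp only [mulOp_apply, lp.star_apply, RCLike.inner_apply, map_mul]
  simp only [RCLike.star_def, RingHomCompTriple.comp_apply, RingHom.id_apply]
  ring

/-- The representation of the bounded functions on `X` as multiplication operators. -/
def mulOpHom (X : Type u) : BddFun X →⋆ₐ[ℂ] (EllTwo X →L[ℂ] EllTwo X) where
  toFun := mulOp
  map_one' := by
    ext1 f; apply ellTwo_ext; intro x
    simp
  map_mul' φ ψ := by
    ext1 f; apply ellTwo_ext; intro x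
    simp [mul_assoc]
  map_zero' := by
    ext1 f; apply ellTwo_ext; intro x
    simp
  map_add' φ ψ := by
    ext1 f; apply ellTwo_ext; intro x
    simp [add_mul]
  commutes' c := by
    ext1 f; apply ellTwo_ext; intro x
    rw [mulOp_apply, Algebra.algebraMap_eq_smul_one, Algebra.algebraMap_eq_smul_one]
    simp
  map_star' := mulOp_adjoint

open Classical in
theorem mulOpHom_injective (X : Type u) : Function.Injective (mulOpHom X) := by
  intro φ ψ h
  apply lp.ext; funext x
  have := congrArg (fun T : EllTwo X →L[ℂ] EllTwo X => T (lp.single 2 x 1) x) h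
  change mulOp φ _ x = mulOp ψ _ x at this
  simpa using this

open Classical in
theorem mem_range_mulOpHom {X : Type u} {T : EllTwo X →L[ℂ] EllTwo X}
    (h : ∀ x, T * mulOp (lp.single ∞ x 1) = mulOp (lp.single ∞ x 1) * T) :
    T ∈ (mulOpHom X).range := by
  have hb : Memℓp (fun x => T (lp.single 2 x 1) x) ∞ := by
    refine memℓp_infty ⟨‖T‖, ?_⟩
    rintro _ ⟨x, rfl⟩
    refine (lp.norm_apply_le_norm two_ne_zero _ x).trans ((T.le_opNorm _).trans ?_)
    rw [lp.norm_single (by simp)]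
    simp
  refine ⟨⟨_, hb⟩, ?_⟩
  change mulOp _ = T
  ext1 f; apply ellTwo_ext; intro x
  have h1 := congrArg (fun S : EllTwo X →L[ℂ] EllTwo X => S f x) (h x)
  simp only [mul_apply_eq_comp, mulOp_apply, lp.single_apply_self, one_mul] at h1
  have h2 : mulOp (lp.single ∞ x 1) f = f x • (lp.single 2 x 1 : EllTwo X) := by
    apply ellTwo_ext; intro y
    rw [mulOp_apply, lp.coeFn_smul, Pi.smul_apply]
    by_cases hxy : y = x
    · subst hxy; simp
    · rw [lp.single_apply_ne _ _ _ hxy, lp.single_apply_ne _ _ _ hxy]; simp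
  rw [h2, map_smul, lp.coeFn_smul, Pi.smul_apply, smul_eq_mul] at h1
  rw [mulOp_apply, ← h1, mul_comm]

open Classical in
/-- `ℓ^∞(X)`: the bounded functions on `X`, acting on `ℓ²(X)` by multiplication. -/
def ellInfty (X : Type u) : VNAlg.{u} where
  H := EllTwo X
  algebra :=
    { toStarSubalgebra := (mulOpHom X).range
      centralizer_centralizer' := by
        refine Set.Subset.antisymm (fun T hT => ?_) Set.subset_centralizer_centralizer
        refine mem_range_mulOpHom (fun x => (hT (mulOp (lp.single ∞ x 1)) ?_).symm)
        rintro _ ⟨φ, rfl⟩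
        change mulOpHom X φ * mulOpHom X _ = mulOpHom X _ * mulOpHom X φ
        rw [← map_mul, ← map_mul]
        congr 1
        apply lp.ext
        exact mul_comm (φ : X → ℂ) _ }

/-- The elements of `ℓ^∞(X)` are the bounded functions on `X`. -/
def ellInftyEquiv (X : Type u) : BddFun X ≃⋆ₐ[ℂ] (ellInfty X).Elt :=
  StarAlgEquiv.ofInjective (mulOpHom X) (mulOpHom_injective X)

/-- Evaluation at a point. -/
def evalHom {X : Type u} (x : X) : BddFun X →⋆ₐ[ℂ] ℂ where
  toFun φ := φ x
  map_one' := rfl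
  map_mul' _ _ := rfl
  map_zero' := rfl
  map_add' _ _ := rfl
  commutes' _ := rfl
  map_star' _ := rfl

theorem starLE_bddFun_iff {X : Type u} {φ ψ : BddFun X} :
    StarLE φ ψ ↔ ∀ x, StarLE (φ x) (ψ x) := by
  refine ⟨fun h x => h.map (evalHom x), fun h => ?_⟩
  choose c hc using h
  have hb : Memℓp c ∞ := by
    refine memℓp_infty ⟨‖ψ - φ‖ + 1, ?_⟩
    rintro _ ⟨x, rfl⟩
    have h1 : ‖c x‖ * ‖c x‖ = ‖ψ x - φ x‖ := by rw [hc x]; simp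
    have h2 : ‖ψ x - φ x‖ ≤ ‖ψ - φ‖ := lp.norm_apply_le_norm ENNReal.top_ne_zero (ψ - φ) x
    show ‖c x‖ ≤ _
    nlinarith [norm_nonneg (c x), sq_nonneg (‖c x‖ - 1)]
  exact ⟨⟨c, hb⟩, lp.ext (funext hc)⟩

open Classical in
theorem isSelfAdjointSup_bddFun_iff {X : Type u} {D : Set (BddFun X)} {s : BddFun X} :
    IsSelfAdjointSup D s ↔ ∀ x, IsSelfAdjointSup (evalHom x '' D) (evalHom x s) := by
  refine ⟨fun h x => ⟨h.isSelfAdjoint.map _, ?_, fun t ht hub => ?_⟩,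
    fun h => ⟨?_, fun d hd => ?_, fun t ht hub => ?_⟩⟩
  · rintro _ ⟨d, hd, rfl⟩
    exact (h.upper d hd).map _
  · have key : ∀ y, (s + lp.single ∞ x (t - s x) : BddFun X) y =
        if y = x then t else s y := by
      intro y
      change s y + lp.single (E := fun _ : X => ℂ) ∞ x (t - s x) y = _
      split_ifs with hy
      · subst hy; simp
      · rw [lp.single_apply_ne _ _ _ hy, add_zero]
    have := h.least (s + lp.single ∞ x (t - s x)) (lp.ext (funext fun y => ?_)) (fun d hd => ?_)
    · have := this.map (evalHom x)
      change StarLE (s x) ((s + lp.single ∞ x (t - s x) : BddFun X) x) at this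
      rw [key, if_pos rfl] at this
      exact this
    · rw [lp.star_apply, key]
      split_ifs with hy
      · exact ht
      · exact h.isSelfAdjoint.map (evalHom y)
    · rw [starLE_bddFun_iff]
      intro y
      rw [key]
      split_ifs with hy
      · subst hy; exact hub _ ⟨d, hd, rfl⟩
      · exact (h.upper d hd).map (evalHom y)
  · exact lp.ext (funext fun x => (h x).isSelfAdjoint)
  · exact starLE_bddFun_iff.2 fun x => (h x).upper _ ⟨d, hd, rfl⟩
  · refine starLE_bddFun_iff.2 fun x => (h x).least _ (ht.map (evalHom x)) ?_
    rintro _ ⟨d, hd, rfl⟩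
    exact (hub d hd).map (evalHom x)

theorem isNormalMap_bddFun_iff {R : Type*} [Ring R] [StarRing R] [Algebra ℂ R] {X : Type u}
    {f : R →⋆ₐ[ℂ] BddFun X} : IsNormalMap f ↔ ∀ x, IsNormalMap ((evalHom x).comp f) := by
  constructor
  · intro h x
    refine IsNormalMap.comp (fun D s _ _ _ hs => isSelfAdjointSup_bddFun_iff.1 hs x) h
  · intro h D s hD hsa hdir hs
    rw [isSelfAdjointSup_bddFun_iff]
    intro x
    rw [Set.image_image]
    exact h x D s hD hsa hdir hs

theorem isNormalMap_evalHom {X : Type u} (x : X) : IsNormalMap (evalHom x) :=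
  isNormalMap_bddFun_iff.1 isNormalMap_id x

/-- Morphisms into `ℓ^∞(X)` from normal MIU-maps into the algebra of bounded functions. -/
def toEllInfty {A : VNAlg.{u}} {X : Type u} (f : A.Elt →⋆ₐ[ℂ] BddFun X) (hf : IsNormalMap f) :
    A ⟶ ellInfty X :=
  VNAlg.Hom.mk ((ellInftyEquiv X : BddFun X →⋆ₐ[ℂ] (ellInfty X).Elt).comp f)
    ((isNormalMap_equiv _).comp hf)

/-- The value of an element of `ℓ^∞(X)` at `x ∈ X`. -/
def ellInftyEval {X : Type u} (x : X) : (ellInfty X).Elt →⋆ₐ[ℂ] ℂ :=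
  (evalHom x).comp ((ellInftyEquiv X).symm : (ellInfty X).Elt →⋆ₐ[ℂ] BddFun X)

theorem isNormalMap_ellInftyEval {X : Type u} (x : X) : IsNormalMap (ellInftyEval x) :=
  (isNormalMap_evalHom x).comp (isNormalMap_equiv _)

theorem ellInfty_ext {X : Type u} {a b : (ellInfty X).Elt} (h : ∀ x, ellInftyEval x a = ellInftyEval x b) :
    a = b :=
  (ellInftyEquiv X).symm.injective (lp.ext (funext h))

@[simp] theorem ellInftyEval_toEllInfty {A : VNAlg.{u}} {X : Type u} (f : A.Elt →⋆ₐ[ℂ] BddFun X)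
    (hf : IsNormalMap f) (a : A.Elt) (x : X) : ellInftyEval x (VNAlg.ap (toEllInfty f hf) a) = f a x := by
  change (ellInftyEquiv X).symm (ellInftyEquiv X (f a)) x = _
  simp

/-- `φ ↦ φ ∘ g` on bounded functions. -/
def precompHom {X Y : Type u} (g : X → Y) : BddFun Y →⋆ₐ[ℂ] BddFun X where
  toFun φ := ⟨fun x => φ (g x), memℓp_infty ⟨‖φ‖, by
    rintro _ ⟨x, rfl⟩
    exact lp.norm_apply_le_norm ENNReal.top_ne_zero φ (g x)⟩⟩
  map_one' := rfl
  map_mul' _ _ := rfl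
  map_zero' := rfl
  map_add' _ _ := rfl
  commutes' _ := rfl
  map_star' _ := rfl

theorem isNormalMap_precompHom {X Y : Type u} (g : X → Y) : IsNormalMap (precompHom g) :=
  isNormalMap_bddFun_iff.2 fun x => isNormalMap_evalHom (g x)

/-- The map `ℓ^∞(Y) ⟶ ℓ^∞(X)`, `φ ↦ φ ∘ g`. -/
def ellInftyMap {X Y : Type u} (g : X → Y) : ellInfty Y ⟶ ellInfty X :=
  toEllInfty ((precompHom g).comp
      ((ellInftyEquiv Y).symm : (ellInfty Y).Elt →⋆ₐ[ℂ] BddFun Y))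
    ((isNormalMap_precompHom g).comp (isNormalMap_equiv _))

@[simp] theorem ellInftyEval_map {X Y : Type u} (g : X → Y) (a : (ellInfty Y).Elt) (x : X) :
    ellInftyEval x (VNAlg.ap (ellInftyMap g) a) = ellInftyEval (g x) a := by
  rw [ellInftyMap, ellInftyEval_toEllInfty]
  rfl

/-- The functor `ℓ^∞ : Set^op ⥤ vNA`, with `ℓ^∞(g)(φ) = φ ∘ g`. -/
def ellInftyFunctor : (Type u)ᵒᵖ ⥤ VNAlg.{u} where
  obj X := ellInfty X.unop
  map g := ellInftyMap g.unop
  map_id X := by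
    apply VNAlg.hom_ext; intro a
    apply ellInfty_ext; intro x
    rw [ellInftyEval_map]
    rfl
  map_comp f g := by
    apply VNAlg.hom_ext; intro a
    apply ellInfty_ext; intro x
    rw [ellInftyEval_map, VNAlg.ap_comp, ellInftyEval_map, ellInftyEval_map]
    rfl

/-! ### The normal spectrum -/

/-- The normal spectrum: the set of normal MIU-maps `A → ℂ`. -/
def Nsp (A : VNAlg.{u}) : Type u := {ω : A.Elt →⋆ₐ[ℂ] ℂ // IsNormalMap ω}

/-- The functor `nsp : vNA ⥤ Set^op`, with `nsp(f)(ω) = ω ∘ f`. -/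
def nspFunctor : VNAlg.{u} ⥤ (Type u)ᵒᵖ where
  obj A := op (Nsp A)
  map {A B} f := Quiver.Hom.op
    (↾(fun ω : Nsp B => (⟨ω.1.comp (VNAlg.ap f), ω.2.comp (VNAlg.Hom.normal f)⟩ : Nsp A)))
  map_id _ := rfl
  map_comp _ _ := rfl

/-- `a ↦ (x ↦ g x a)`, for a family of normal MIU-maps `g x : A → ℂ`. -/
def transposeHom {A : VNAlg.{u}} {X : Type u} (g : X → Nsp A) : A.Elt →⋆ₐ[ℂ] BddFun X where
  toFun a := ⟨fun x => (g x).1 a, memℓp_infty ⟨‖a‖, by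
    rintro _ ⟨x, rfl⟩
    exact NonUnitalStarAlgHom.norm_apply_le (g x).1 a⟩⟩
  map_one' := lp.ext (funext fun x => map_one (g x).1)
  map_mul' a b := lp.ext (funext fun x => map_mul (g x).1 a b)
  map_zero' := lp.ext (funext fun x => map_zero (g x).1)
  map_add' a b := lp.ext (funext fun x => map_add (g x).1 a b)
  commutes' c := lp.ext (funext fun x => AlgHomClass.commutes (g x).1 c)
  map_star' a := lp.ext (funext fun x => map_star (g x).1 a)

/-- The morphism `A ⟶ ℓ^∞(X)` obtained from `g : X → nsp A` by swapping arguments. -/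
def transpose {A : VNAlg.{u}} {X : Type u} (g : X → Nsp A) : A ⟶ ellInfty X :=
  toEllInfty (transposeHom g) (isNormalMap_bddFun_iff.2 fun x => (g x).2)

@[simp] theorem ellInftyEval_transpose {A : VNAlg.{u}} {X : Type u} (g : X → Nsp A) (a : A.Elt)
    (x : X) : ellInftyEval x (VNAlg.ap (transpose g) a) = (g x).1 a :=
  ellInftyEval_toEllInfty _ _ a x

/-- The adjunction `nsp ⊣ ℓ^∞`: a morphism `f : A ⟶ ℓ^∞(X)` corresponds to the map
`g : X → nsp A` with `g x a = f a x`. -/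
def nspAdjunction : nspFunctor.{u} ⊣ ellInftyFunctor.{u} :=
  Adjunction.mkOfHomEquiv
    { homEquiv := fun A X =>
        { toFun := fun g => transpose g.unop
          invFun := fun f => Quiver.Hom.op
            (↾(fun x : X.unop => (⟨(ellInftyEval x).comp (VNAlg.ap f),
              (isNormalMap_ellInftyEval x).comp (VNAlg.Hom.normal f)⟩ : Nsp A)))
          left_inv := fun g => by
            apply Quiver.Hom.unop_inj
            ext x
            apply Subtype.ext
            apply StarAlgHom.ext
            intro a
            exact ellInftyEval_transpose g.unop a x
          right_inv := fun f => by
            apply VNAlg.hom_ext; intro a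
            apply ellInfty_ext; intro x
            exact ellInftyEval_transpose (A := A) (X := X.unop) _ a x }
      homEquiv_naturality_left_symm := fun _ _ => rfl
      homEquiv_naturality_right := fun f g => by
        apply VNAlg.hom_ext; intro a
        apply ellInfty_ext; intro x
        refine (ellInftyEval_transpose (f ≫ g).unop a x).trans (Eq.symm ?_)
        exact (ellInftyEval_map g.unop (VNAlg.ap (transpose f.unop) a) x).trans
          (ellInftyEval_transpose f.unop a (g.unop x)) }

theorem ellInftyEval_nspAdjunction_homEquiv {A : VNAlg.{u}} {X : Type u} (g : X ⟶ Nsp A) (x : X)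
    (a : A.Elt) :
    ellInftyEval x (VNAlg.ap (nspAdjunction.homEquiv A (op X) g.op) a) = (g x).1 a := by
  rw [nspAdjunction, Adjunction.mkOfHomEquiv_homEquiv]
  exact ellInftyEval_transpose g a x

end

/-! Everything rests on describing normal maps by intertwiners, that is, operators `X` from `A.H` to
`B.H` with `f a ∘ X = X ∘ a`. A unital `*`-homomorphism is normal exactly when the ranges of its
intertwiners span a dense subspace (`isNormalMap_of_isTotal`, `isTotal_intertwiners`). The easy
direction uses that bounded monotone nets converge strongly to their suprema. The hard one compares
vector functionals, with two applications of Zorn's lemma.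

Morphisms can then be built and compared on generators. A total family of operators under which a
generating set of `A` is matched with elements of `B`, compatibly with adjoints, induces a unique
compatible normal map (`exists_hom_of_generates`). Two normal maps which agree on a generating set
are equal (`hom_ext_of_generates`). Since the operators `a ⊗ b` generate the spatial tensor product,
`f ⊗ g`, the symmetry, the associator and the unitors arise from evident operators between Hilbert
spaces, and all coherence laws are checked on elementary tensors.

For `ℓ^∞`, the operators matching `e_x ⊗ e_y` with `e_(x,y)` give the isomorphism `ℓ^∞(X) ⊗ ℓ^∞(Y) ≅
ℓ^∞(X × Y)`, so `ℓ^∞` is strong symmetric monoidal. Its left adjoint `nsp` is therefore oplax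
monoidal, with unit and counit monoidal by doctrinal adjunction. The oplax structure map sends `(ω₁,
ω₂)` to their product functional. It is bijective because a normal character of `A ⊗ B` is
determined by its restrictions to the two factors, which are arbitrary. -/

noncomputable section

open Filter Topology ContinuousLinearMap
open scoped InnerProductSpace ComplexOrder

/-! ### Monotone nets of operators -/

section operators

variable {H : Type*} [NormedAddCommGroup H] [InnerProductSpace ℂ H] [CompleteSpace H]

omit [CompleteSpace H] in
theorem nonneg_iff_inner_nonneg {a : H →L[ℂ] H} : 0 ≤ a ↔ ∀ x, 0 ≤ ⟪a x, x⟫_ℂ := by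
  rw [nonneg_iff_isPositive, isPositive_iff_complex]
  refine forall_congr' fun x => ?_
  rw [Complex.nonneg_iff]
  constructor
  · rintro ⟨h1, h2⟩
    exact ⟨h2, by rw [← h1]; rfl⟩
  · rintro ⟨h1, h2⟩
    exact ⟨Complex.ext rfl h2, h1⟩

omit [CompleteSpace H] in
theorem le_iff_inner_le {a b : H →L[ℂ] H} : a ≤ b ↔ ∀ x, ⟪a x, x⟫_ℂ ≤ ⟪b x, x⟫_ℂ := by
  rw [ContinuousLinearMap.le_def, ← nonneg_iff_isPositive, nonneg_iff_inner_nonneg]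
  simp only [sub_apply, inner_sub_left, sub_nonneg]

/-- The commutation clause is what later places the root inside any von Neumann algebra containing
`a`. -/
theorem exists_sqrt_of_nonneg {a : H →L[ℂ] H} (ha : 0 ≤ a) :
    ∃ r : H →L[ℂ] H, star r = r ∧ r * r = a ∧ ∀ c, Commute a c → Commute r c :=
  ⟨CFC.sqrt a, (CFC.sqrt_nonneg a).isSelfAdjoint, CFC.sqrt_mul_sqrt_self a,
    fun c hc => by
      rw [CFC.sqrt_eq_cfc]
      exact (hc.cfc_nnreal _)⟩

/-- With `a = r * r` and `r` self-adjoint, `‖r (r x)‖ ≤ ‖r‖ ‖r x‖`, while `‖r‖ ^ 2 = ‖a‖` and `‖r x‖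
^ 2` is the quadratic form of `a` at `x`. -/
theorem norm_apply_sq_le_of_nonneg {a : H →L[ℂ] H} (ha : 0 ≤ a) (x : H) :
    ‖a x‖ ^ 2 ≤ ‖a‖ * a.reApplyInnerSelf x := by
  obtain ⟨r, hr, rfl, -⟩ := exists_sqrt_of_nonneg ha
  have h1 : (r * r).reApplyInnerSelf x = ‖r x‖ ^ 2 := by
    rw [reApplyInnerSelf_apply, mul_apply_eq_comp]
    nth_rw 1 [← hr]
    rw [star_eq_adjoint, adjoint_inner_left, inner_self_eq_norm_sq]
  have h2 : ‖r * r‖ = ‖r‖ ^ 2 := by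
    nth_rw 1 [← hr]
    rw [CStarRing.norm_star_mul_self, sq]
  rw [h1, h2, ← mul_pow]
  gcongr
  exact r.le_opNorm _

/-- A bounded monotone net of operators converges pointwise to its supremum. -/
theorem exists_isLUB_tendsto_of_monotone {ι : Type*} [Preorder ι] [IsDirectedOrder ι] [Nonempty ι]
    {d : ι → H →L[ℂ] H} (hd : Monotone d) {u : H →L[ℂ] H} (hu : ∀ i, d i ≤ u) :
    ∃ s, IsLUB (Set.range d) s ∧ ∀ x, Tendsto (fun i => d i x) atTop (𝓝 (s x)) := by
  obtain ⟨i₀⟩ := ‹Nonempty ι›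
  set K : ℝ := ‖u - d i₀‖ with hK
  -- The increments `d j - d i` are positive with norm at most `K`, so pointwise Cauchyness reduces
  -- to convergence of the monotone bounded real nets of quadratic forms.
  have key : ∀ i j, i₀ ≤ i → i ≤ j → ∀ x, ‖d j x - d i x‖ ^ 2 ≤
      K * ((d j - d i₀).reApplyInnerSelf x - (d i - d i₀).reApplyInnerSelf x) := by
    intro i j hi hij x
    have h0 : 0 ≤ d j - d i := sub_nonneg.2 (hd hij)
    have h1 := norm_apply_sq_le_of_nonneg h0 x
    have h2 : ‖d j - d i‖ ≤ K :=
      CStarAlgebra.norm_le_norm_of_nonneg_of_le h0 (sub_le_sub (hu j) (hd hi))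
    have h3 : (d j - d i₀).reApplyInnerSelf x - (d i - d i₀).reApplyInnerSelf x =
        (d j - d i).reApplyInnerSelf x := by
      simp [reApplyInnerSelf_apply, inner_sub_left]
    rw [h3]
    refine h1.trans (mul_le_mul_of_nonneg_right h2 ?_)
    exact ((nonneg_iff_isPositive _).1 h0).re_inner_nonneg_left x
  have hq : ∀ x, ∃ l, Tendsto (fun i => (d i - d i₀).reApplyInnerSelf x) atTop (𝓝 l) := by
    intro x
    refine ⟨_, tendsto_atTop_ciSup (fun i j hij => ?_) ⟨(u - d i₀).reApplyInnerSelf x, ?_⟩⟩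
    · have := ((ContinuousLinearMap.le_def _ _).1 (hd hij)).re_inner_nonneg_left x
      simp only [reApplyInnerSelf_apply, sub_apply, inner_sub_left, map_sub] at this ⊢
      linarith
    · rintro _ ⟨i, rfl⟩
      have := ((ContinuousLinearMap.le_def _ _).1 (hu i)).re_inner_nonneg_left x
      simp only [reApplyInnerSelf_apply, sub_apply, inner_sub_left, map_sub] at this ⊢
      linarith
  have hlim : ∀ x, ∃ y, Tendsto (fun i => d i x) atTop (𝓝 y) := by
    intro x
    refine cauchy_map_iff_exists_tendsto.1 ?_
    obtain ⟨l, hl⟩ := hq x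
    have hle : ∀ i, i₀ ≤ i → (d i - d i₀).reApplyInnerSelf x ≤ l := by
      intro i hi
      refine ge_of_tendsto hl ((eventually_ge_atTop i).mono fun j hij => ?_)
      have := ((ContinuousLinearMap.le_def _ _).1 (hd hij)).re_inner_nonneg_left x
      simp only [reApplyInnerSelf_apply, sub_apply, inner_sub_left, map_sub] at this ⊢
      linarith
    rw [Metric.cauchy_iff]
    refine ⟨inferInstance, fun ε hε => ?_⟩
    -- Chosen so that `K` times this number is below `(ε / 2) ^ 2`; the denominator is `K + 1` since
    -- `K` may vanish.
    have hpos : 0 < (ε / 2) ^ 2 / (K + 1) := by positivity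
    obtain ⟨i₁, hi₁⟩ := ((hl.eventually (lt_mem_nhds (sub_lt_self l hpos))).and
      (eventually_ge_atTop i₀)).exists
    refine ⟨(fun i => d i x) '' Set.Ici i₁, image_mem_map (Ici_mem_atTop i₁), ?_⟩
    have hd1 : ∀ j, i₁ ≤ j → dist (d j x) (d i₁ x) < ε / 2 := by
      intro j hj
      rw [dist_eq_norm]
      refine lt_of_pow_lt_pow_left₀ 2 (by positivity) ((key i₁ j hi₁.2 hj x).trans_lt ?_)
      have h1 := hle j (hi₁.2.trans hj)
      have h2 : K * ((d j - d i₀).reApplyInnerSelf x - (d i₁ - d i₀).reApplyInnerSelf x) ≤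
          K * ((ε / 2) ^ 2 / (K + 1)) :=
        mul_le_mul_of_nonneg_left (by linarith [hi₁.1]) (norm_nonneg _)
      refine h2.trans_lt ?_
      have hK0 : 0 ≤ K := norm_nonneg _
      rw [mul_div_assoc', div_lt_iff₀ (by positivity)]
      nlinarith [sq_pos_of_pos (half_pos hε)]
    rintro _ ⟨i, hi, rfl⟩ _ ⟨j, hj, rfl⟩
    have := dist_triangle_right (d i x) (d j x) (d i₁ x)
    have h1 := hd1 i hi
    have h2 := hd1 j hj
    change dist (d i x) (d j x) < ε
    linarith
  choose s hs using hlim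
  let S₀ : H →ₗ[ℂ] H :=
    linearMapOfTendsto (l := atTop) s (fun i => (d i : H →ₗ[ℂ] H)) (tendsto_pi_nhds.2 hs)
  let S : H →L[ℂ] H := S₀.mkContinuous (‖d i₀‖ + K) (fun x => by
    refine le_of_tendsto (hs x).norm ((eventually_ge_atTop i₀).mono fun i hi => ?_)
    have h0 : 0 ≤ d i - d i₀ := sub_nonneg.2 (hd hi)
    have h2 : ‖d i - d i₀‖ ≤ K :=
      CStarAlgebra.norm_le_norm_of_nonneg_of_le h0 (sub_le_sub_right (hu i) _)
    calc ‖d i x‖ ≤ ‖d i‖ * ‖x‖ := (d i).le_opNorm x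
      _ ≤ (‖d i₀‖ + K) * ‖x‖ := by
        gcongr
        calc ‖d i‖ = ‖d i₀ + (d i - d i₀)‖ := by rw [add_sub_cancel]
          _ ≤ _ := (norm_add_le _ _).trans (by gcongr))
  have hS : ∀ x, S x = s x := fun x => rfl
  have hinner : ∀ x, Tendsto (fun i => ⟪d i x, x⟫_ℂ) atTop (𝓝 ⟪S x, x⟫_ℂ) := fun x =>
    (hs x).inner tendsto_const_nhds
  refine ⟨S, ⟨?_, fun v hv => ?_⟩, hs⟩
  · rintro _ ⟨i, rfl⟩
    exact le_iff_inner_le.2 fun x => ge_of_tendsto (hinner x)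
      ((eventually_ge_atTop i).mono fun j hj => le_iff_inner_le.1 (hd hj) x)
  · exact le_iff_inner_le.2 fun x => le_of_tendsto (hinner x)
      (.of_forall fun j => le_iff_inner_le.1 (hv ⟨j, rfl⟩) x)

end operators

namespace VNAlg

/-! ### Order and suprema in a von Neumann algebra -/

variable {A B : VNAlg.{u}}

theorem mem_of_forall_commute {t : A.H →L[ℂ] A.H}
    (h : ∀ y ∈ A.algebra.commutant, y * t = t * y) : t ∈ A.algebra := by
  rw [← A.algebra.commutant_commutant, VonNeumannAlgebra.mem_commutant_iff]
  exact h

/-- The operator square root commutes with the commutant of `A`, hence lies in the bicommutant,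
which is `A`. -/
theorem exists_sqrt {a : A.Elt} (ha : 0 ≤ a.1) : ∃ r : A.Elt, star r = r ∧ r * r = a := by
  obtain ⟨r, hr, hra, hc⟩ := exists_sqrt_of_nonneg ha
  refine ⟨⟨r, mem_of_forall_commute fun y hy => ?_⟩, Subtype.ext hr, Subtype.ext hra⟩
  exact (hc y ((VonNeumannAlgebra.mem_commutant_iff.1 hy) a.1 a.2)).symm

/-- The algebraic order agrees with the operator order because square roots stay inside the algebra.
Suprema in `A` can thus be studied through quadratic forms. -/
theorem starLE_iff {a b : A.Elt} : StarLE a b ↔ a ≤ b := by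
  constructor
  · rintro ⟨c, hc⟩
    change a.1 ≤ b.1
    rw [← sub_nonneg]
    have : b.1 - a.1 = star c.1 * c.1 := congrArg Subtype.val hc
    rw [this]
    exact star_mul_self_nonneg _
  · intro h
    obtain ⟨r, hr, hra⟩ := exists_sqrt (a := b - a) (sub_nonneg.2 (show a.1 ≤ b.1 from h))
    exact ⟨r, by rw [hr, hra]⟩

theorem map_le_map (f : A.Elt →⋆ₐ[ℂ] B.Elt) {a b : A.Elt} (h : a ≤ b) : f a ≤ f b :=
  starLE_iff.1 ((starLE_iff.2 h).map f)

theorem isSelfAdjoint_of_le {a b : A.Elt} (h : a ≤ b) (ha : IsSelfAdjoint a) :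
    IsSelfAdjoint b := by
  obtain ⟨c, hc⟩ := starLE_iff.2 h
  rw [sub_eq_iff_eq_add] at hc
  rw [hc]
  exact (IsSelfAdjoint.star_mul_self c).add ha

section nets

variable {ι : Type*} [Preorder ι] [IsDirectedOrder ι] [Nonempty ι] {d : ι → A.Elt}

/-- A bounded monotone net in a von Neumann algebra has a supremum. -/
theorem exists_isSelfAdjointSup (hd : Monotone d) (hsa : ∀ i, IsSelfAdjoint (d i)) {u : A.Elt}
    (hu : ∀ i, d i ≤ u) : ∃ s : A.Elt, IsSelfAdjointSup (Set.range d) s ∧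
      ∀ x, Tendsto (fun i => (d i).1 x) atTop (𝓝 (s.1 x)) := by
  obtain ⟨s, hs, hlim⟩ := exists_isLUB_tendsto_of_monotone (d := fun i => (d i).1)
    (fun i j hij => hd hij) (u := u.1) hu
  -- Commuting with a fixed `y` passes to pointwise limits.
  have hmem : s ∈ A.algebra := mem_of_forall_commute fun y hy => by
    ext x
    refine tendsto_nhds_unique ((y.continuous.tendsto _).comp (hlim x)) ?_
    refine (hlim (y x)).congr fun i => ?_
    exact DFunLike.congr_fun (VonNeumannAlgebra.mem_commutant_iff.1 hy _ (d i).2) x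
  have hub : ∀ i, d i ≤ (⟨s, hmem⟩ : A.Elt) := fun i => hs.1 ⟨i, rfl⟩
  refine ⟨⟨s, hmem⟩, ⟨?_, ?_, fun t _ ht => ?_⟩, hlim⟩
  · obtain ⟨i⟩ := ‹Nonempty ι›
    exact isSelfAdjoint_of_le (hub i) (hsa i)
  · rintro _ ⟨i, rfl⟩
    exact starLE_iff.2 (hub i)
  · refine starLE_iff.2 (hs.2 ?_ : s ≤ t.1)
    rintro _ ⟨i, rfl⟩
    exact (starLE_iff.1 (ht _ ⟨i, rfl⟩) : (d i).1 ≤ t.1)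

/-- A monotone net in a von Neumann algebra converges pointwise to its supremum. -/
theorem _root_.IsSelfAdjointSup.tendsto {s : A.Elt} (hs : IsSelfAdjointSup (Set.range d) s)
    (hd : Monotone d) (hsa : ∀ i, IsSelfAdjoint (d i)) (x : A.H) :
    Tendsto (fun i => (d i).1 x) atTop (𝓝 (s.1 x)) := by
  obtain ⟨s', hs', hlim⟩ := exists_isSelfAdjointSup hd hsa
    (fun i => starLE_iff.1 (hs.upper _ ⟨i, rfl⟩))
  have h1 := starLE_iff.1 (hs.least s' hs'.isSelfAdjoint hs'.upper)
  have h2 := starLE_iff.1 (hs'.least s hs.isSelfAdjoint hs.upper)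
  rw [le_antisymm h1 h2]
  exact hlim x

end nets

/-! ### Intertwiners and normality -/

/-- The ranges of the operators in `𝓧` span a dense subspace. -/
def IsTotal {H K : Type*} [NormedAddCommGroup H] [InnerProductSpace ℂ H]
    [NormedAddCommGroup K] [InnerProductSpace ℂ K] (𝓧 : Set (H →L[ℂ] K)) : Prop :=
  Dense (Submodule.span ℂ {y | ∃ X ∈ 𝓧, ∃ x, X x = y} : Set K)

section total

variable {H K L : Type*} [NormedAddCommGroup H] [InnerProductSpace ℂ H]
  [NormedAddCommGroup K] [InnerProductSpace ℂ K] {𝓧 : Set (H →L[ℂ] K)}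
  [NormedAddCommGroup L] [InnerProductSpace ℂ L]

theorem IsTotal.ext (h : IsTotal 𝓧) {S T : K →L[ℂ] L} (hST : ∀ X ∈ 𝓧, S ∘L X = T ∘L X) :
    S = T := by
  refine ContinuousLinearMap.ext_on h ?_
  rintro _ ⟨X, hX, x, rfl⟩
  exact DFunLike.congr_fun (hST X hX) x

theorem isTotal_of_forall_inner [CompleteSpace K]
    (h : ∀ y : K, (∀ X ∈ 𝓧, ∀ x, ⟪X x, y⟫_ℂ = 0) → y = 0) : IsTotal 𝓧 := by
  rw [IsTotal, Submodule.dense_iff_topologicalClosure_eq_top,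
    Submodule.topologicalClosure_eq_top_iff, Submodule.eq_bot_iff]
  intro y hy
  exact h y fun X hX x => (Submodule.mem_orthogonal _ _).1 hy _
    (Submodule.subset_span ⟨X, hX, x, rfl⟩)

end total

/-- The operators which intertwine a representation with the identity representation. -/
def intertwiners (f : A.Elt →⋆ₐ[ℂ] B.Elt) : Set (A.H →L[ℂ] B.H) :=
  {X | ∀ a, (f a).1 ∘L X = X ∘L a.1}

/-- On the range of an intertwiner, `f d (X x) = X (d x)` tends to `X (s x) = f s (X x)`. By
linearity `f d` tends to `f s` on a dense subspace, so an upper bound `t` of the `f d` satisfies `⟪f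
s y, y⟫ ≤ ⟪t y, y⟫` there, and everywhere by continuity. -/
theorem isNormalMap_of_isTotal {f : A.Elt →⋆ₐ[ℂ] B.Elt} (h : IsTotal (intertwiners f)) :
    IsNormalMap f := by
  intro D s hD hsa hdir hs
  refine ⟨hs.isSelfAdjoint.map f, ?_, fun t _ ht => ?_⟩
  · rintro _ ⟨d, hd, rfl⟩
    exact (hs.upper d hd).map f
  · have : Nonempty D := hD.to_subtype
    have : IsDirectedOrder D := ⟨fun a b => by
      obtain ⟨c, hc, hac, hbc⟩ := hdir a a.2 b b.2
      exact ⟨⟨c, hc⟩, starLE_iff.1 hac, starLE_iff.1 hbc⟩⟩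
    have hlim : ∀ x, Tendsto (fun d : D => d.1.1 x) atTop (𝓝 (s.1 x)) :=
      IsSelfAdjointSup.tendsto (d := fun d : D => d.1) (by simpa using hs) (fun _ _ h => h)
        (fun d => hsa d d.2)
    refine starLE_iff.2 (le_iff_inner_le.2 ?_ : (f s).1 ≤ t.1)
    intro x
    suffices hsub : (Submodule.span ℂ {y | ∃ X ∈ intertwiners f, ∃ x : A.H, X x = y} : Set B.H) ⊆
        {x | ⟪(f s).1 x, x⟫_ℂ ≤ ⟪t.1 x, x⟫_ℂ} from
      closure_minimal hsub (isClosed_le ((f s).1.continuous.inner (𝕜 := ℂ) continuous_id)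
        (t.1.continuous.inner (𝕜 := ℂ) continuous_id)) (h x)
    intro y hy
    have hy' : Tendsto (fun d : D => (f d.1).1 y) atTop (𝓝 ((f s).1 y)) := by
      induction hy using Submodule.span_induction with
      | mem y hy =>
        obtain ⟨X, hX, x, rfl⟩ := hy
        have h1 : ∀ a, (f a).1 (X x) = X (a.1 x) := fun a => DFunLike.congr_fun (hX a) x
        simp only [h1]
        exact (X.continuous.tendsto _).comp (hlim x)
      | zero => simp
      | add x y _ _ hx hy => simpa using hx.add hy
      | smul c x _ hx => simpa using hx.const_smul c
    change ⟪(f s).1 y, y⟫_ℂ ≤ ⟪t.1 y, y⟫_ℂ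
    refine le_of_tendsto (hy'.inner tendsto_const_nhds) (.of_forall fun d => ?_)
    exact le_iff_inner_le.1 (starLE_iff.1 (ht _ ⟨d, d.2, rfl⟩) : (f d.1).1 ≤ t.1) y

end VNAlg

/-! ### Normal functionals, and totality of the intertwiners of a normal map. -/

namespace VNAlg
variable {A B : VNAlg.{u}}

/-- Continuity of real functionals along monotone nets of positive elements with a supremum. -/
def IsNormalFunctional (g : A.Elt →ₗ[ℝ] ℝ) : Prop :=
  ∀ (D : Set A.Elt) (s : A.Elt), D.Nonempty → (∀ d ∈ D, IsSelfAdjoint d) → DirectedOn (· ≤ ·) D →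
    IsSelfAdjointSup D s → Tendsto (fun d : D => g d) atTop (𝓝 (g s))

theorem IsNormalFunctional.sub {g h : A.Elt →ₗ[ℝ] ℝ} (hg : IsNormalFunctional g)
    (hh : IsNormalFunctional h) : IsNormalFunctional (g - h) :=
  fun D s hD hsa hdir hs => (hg D s hD hsa hdir hs).sub (hh D s hD hsa hdir hs)

/-- `a ↦ re ⟪f a x, x⟫` -/
def vectorFunctional (f : A.Elt →⋆ₐ[ℂ] B.Elt) (x : B.H) : A.Elt →ₗ[ℝ] ℝ where
  toFun a := ((f a).1).reApplyInnerSelf x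
  map_add' a b := by
    simp [reApplyInnerSelf_apply, inner_add_left]
  map_smul' c a := by
    have : f (c • a) = (c : ℂ) • f a := by
      rw [← map_smul]; rfl
    rw [this]
    simp [reApplyInnerSelf_apply]

theorem vectorFunctional_apply (f : A.Elt →⋆ₐ[ℂ] B.Elt) (x : B.H) (a : A.Elt) :
    vectorFunctional f x a = RCLike.re ⟪(f a).1 x, x⟫_ℂ := rfl

theorem vectorFunctional_star_mul_self (f : A.Elt →⋆ₐ[ℂ] B.Elt) (x : B.H) (a : A.Elt) :
    vectorFunctional f x (star a * a) = ‖(f a).1 x‖ ^ 2 := by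
  rw [vectorFunctional_apply, map_mul, map_star]
  change RCLike.re ⟪star (f a).1 ((f a).1 x), x⟫_ℂ = _
  rw [star_eq_adjoint, adjoint_inner_left, inner_self_eq_norm_sq]

theorem isNormalFunctional_vectorFunctional {f : A.Elt →⋆ₐ[ℂ] B.Elt} (hf : IsNormalMap f)
    (x : B.H) : IsNormalFunctional (vectorFunctional f x) := by
  intro D s hD hsa hdir hs
  have : Nonempty D := hD.to_subtype
  have : IsDirectedOrder D := ⟨fun a b => by
    obtain ⟨c, hc, hac, hbc⟩ := hdir a a.2 b b.2
    exact ⟨⟨c, hc⟩, hac, hbc⟩⟩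
  have h := hf D s hD hsa (hdir.mono fun _ _ h => starLE_iff.2 h) hs
  have h2 : IsSelfAdjointSup (Set.range fun d : D => f d.1) (f s) := by
    rwa [Set.image_eq_range] at h
  have := h2.tendsto (fun a b hab => map_le_map f hab) (fun d => (hsa d d.2).map f) x
  exact (RCLike.continuous_re.tendsto _).comp (this.inner (𝕜 := ℂ) tendsto_const_nhds)

/-- Zorn's lemma: chains have suprema in `A`, and normality keeps `g` nonnegative at them.
Maximality makes `g` strictly negative on all nonzero positive elements below `e - a`, as such an
element could otherwise be added to `a`. -/
theorem exists_maximal_nonneg {g : A.Elt →ₗ[ℝ] ℝ} (hg : IsNormalFunctional g) {e : A.Elt}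
    (he : 0 ≤ e) : ∃ a, 0 ≤ a ∧ a ≤ e ∧ 0 ≤ g a ∧
      ∀ c, 0 ≤ c → c ≤ e - a → 0 ≤ g c → c = 0 := by
  obtain ⟨a, -, ⟨h0, h1, h2⟩, hmax⟩ :=
    zorn_le_nonempty₀ {a : A.Elt | 0 ≤ a ∧ a ≤ e ∧ 0 ≤ g a} (by
      intro C hC hchain y hy
      have hne : Nonempty C := ⟨⟨y, hy⟩⟩
      have hdir : DirectedOn (· ≤ ·) C := hchain.directedOn
      have : IsDirectedOrder C := ⟨fun a b => by
        obtain ⟨c, hc, hac, hbc⟩ := hdir a a.2 b b.2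
        exact ⟨⟨c, hc⟩, hac, hbc⟩⟩
      have hsa : ∀ c ∈ C, IsSelfAdjoint c := fun c hc =>
        isSelfAdjoint_of_le (hC hc).1 (IsSelfAdjoint.zero _)
      obtain ⟨s, hs, -⟩ := exists_isSelfAdjointSup (d := fun c : C => c.1) (fun _ _ h => h)
        (fun c => hsa c c.2) (u := e) (fun c => (hC c.2).2.1)
      have hs : IsSelfAdjointSup C s := by simpa using hs
      refine ⟨s, ⟨(hC hy).1.trans (starLE_iff.1 (hs.upper y hy)), ?_, ?_⟩,
        fun z hz => starLE_iff.1 (hs.upper z hz)⟩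
      · exact starLE_iff.1 (hs.least e (isSelfAdjoint_of_le he (IsSelfAdjoint.zero _))
          fun d hd => starLE_iff.2 (hC hd).2.1)
      · exact ge_of_tendsto' (hg C s ⟨y, hy⟩ hsa hdir hs) fun c => (hC c.2).2.2)
      0 ⟨le_rfl, he, by simp⟩
  refine ⟨a, h0, h1, h2, fun c hc0 hc1 hc2 => ?_⟩
  have hadd : ∀ {x y z w : A.Elt}, x ≤ y → z ≤ w → x + z ≤ y + w := fun {x y z w} h h' =>
    (add_le_add (show x.1 ≤ y.1 from h) (show z.1 ≤ w.1 from h') : x.1 + z.1 ≤ y.1 + w.1)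
  have hle : a ≤ a + c := by simpa using hadd (le_refl a) hc0
  have := hmax ⟨h0.trans hle, by simpa using hadd (le_refl a) hc1, by
    rw [map_add]; positivity⟩ hle
  have := le_antisymm hle this
  simpa using this.symm

/-- Rescaling by `(1 + ‖m‖)⁻¹` reduces to contractions, without separating the case `m = 0`. -/
theorem norm_le_of_forall_norm_le_one {f : A.Elt →⋆ₐ[ℂ] B.Elt} {x : A.H} {ξ : B.H}
    (h : ∀ m : A.Elt, ‖m.1‖ ≤ 1 → ‖(f m).1 ξ‖ ≤ ‖m.1 x‖) (m : A.Elt) :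
    ‖(f m).1 ξ‖ ≤ ‖m.1 x‖ := by
  have hpos : (0 : ℝ) < 1 + ‖m.1‖ := by positivity
  have hc : ‖(((1 + ‖m.1‖)⁻¹ : ℝ) : ℂ)‖ = (1 + ‖m.1‖)⁻¹ := by
    rw [Complex.norm_real, Real.norm_eq_abs, abs_of_pos (by positivity)]
  have h1 := h ((((1 + ‖m.1‖)⁻¹ : ℝ) : ℂ) • m) (by
    change ‖(((1 + ‖m.1‖)⁻¹ : ℝ) : ℂ) • m.1‖ ≤ 1
    rw [norm_smul, hc, inv_mul_le_one₀ hpos]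
    linarith)
  rw [map_smul] at h1
  change ‖(((1 + ‖m.1‖)⁻¹ : ℝ) : ℂ) • (f m).1 ξ‖ ≤ ‖(((1 + ‖m.1‖)⁻¹ : ℝ) : ℂ) • m.1 x‖ at h1
  rw [norm_smul, norm_smul, hc] at h1
  exact le_of_mul_le_mul_left h1 (by positivity)

/-- A vector whose state dominates that of another one is mapped to it by an intertwiner. -/
theorem exists_intertwiner {f : A.Elt →⋆ₐ[ℂ] B.Elt} {x : A.H} {ξ : B.H}
    (h : ∀ m : A.Elt, ‖(f m).1 ξ‖ ≤ ‖m.1 x‖) : ∃ T ∈ intertwiners f, T x = ξ := by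
  let e : A.Elt →ₗ[ℂ] A.H :=
    { toFun := fun m => m.1 x
      map_add' := fun _ _ => rfl
      map_smul' := fun _ _ => rfl }
  let F : A.Elt →ₗ[ℂ] B.H :=
    { toFun := fun m => (f m).1 ξ
      map_add' := fun m n => by rw [map_add]; rfl
      map_smul' := fun c m => by rw [map_smul]; rfl }
  let W : Submodule ℂ A.H := (LinearMap.range e).topologicalClosure
  have : CompleteSpace W := (Submodule.isClosed_topologicalClosure _).completeSpace_coe
  have heW : ∀ m, e m ∈ W := fun m => Submodule.le_topologicalClosure _ ⟨m, rfl⟩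
  let e' : A.Elt →ₗ[ℂ] W := e.codRestrict W heW
  have hdense : DenseRange e' := by
    intro w
    rw [closure_subtype, ← Set.range_comp]
    exact w.2
  -- The assignment `m x ↦ f m ξ` is contractive by `h`, which also makes it well defined, so it
  -- extends to the closure `W` of the orbit of `x`.
  have hext : ∀ m, F.extendOfNorm e' (e' m) = F m :=
    LinearMap.extendOfNorm_eq hdense ⟨1, fun m => (h m).trans_eq (one_mul _).symm⟩
  -- The extension is zero on `Wᗮ`. It still intertwines, because `Wᗮ` is invariant along with `W`,
  -- the algebra being closed under adjoints.
  let T : A.H →L[ℂ] B.H := F.extendOfNorm e' ∘L W.orthogonalProjectionOnto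
  have hTW : ∀ w : W, T w = F.extendOfNorm e' w := fun w => by
    simp [T]
  have hTe : ∀ m, T (e m) = F m := fun m => (hTW (e' m)).trans (hext m)
  have hTo : ∀ z ∈ Wᗮ, T z = 0 := fun z hz => by
    simp [T, Submodule.orthogonalProjectionOnto_apply_of_mem_orthogonal hz]
  have hWa : ∀ a : A.Elt, ∀ w ∈ W, a.1 w ∈ W := by
    intro a
    refine (LinearMap.range e).topologicalClosure_minimal
      (t := W.comap (a.1 : A.H →ₗ[ℂ] A.H)) ?_ ?_
    · rintro _ ⟨m, rfl⟩
      exact heW (a * m)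
    · exact (Submodule.isClosed_topologicalClosure _).preimage a.1.continuous
  refine ⟨T, fun a => ?_, ?_⟩
  · ext z
    obtain ⟨w, hw, v, hv, rfl⟩ := W.exists_add_mem_mem_orthogonal z
    have hv' : a.1 v ∈ Wᗮ := by
      rw [Submodule.mem_orthogonal]
      intro u hu
      rw [← adjoint_inner_left]
      exact (Submodule.mem_orthogonal _ _).1 hv _ (hWa (star a) u hu)
    simp only [ContinuousLinearMap.comp_apply, map_add, hTo v hv, hTo _ hv', map_zero, add_zero]
    have : ∀ w : W, (f a).1 (T w) = T (a.1 w) := by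
      intro w
      refine hdense.induction_on w (isClosed_eq (by fun_prop) (by fun_prop)) fun m => ?_
      change (f a).1 (T (e m)) = T (e (a * m))
      rw [hTe, hTe]
      change _ = (f (a * m)).1 ξ
      rw [map_mul]
      rfl
    exact this ⟨w, hw⟩
  · have := hTe 1
    simpa [e, F] using this

/-- Suppose `ξ ≠ 0` is orthogonal to the ranges of all intertwiners, and let `φ` be its vector
functional. Cutting down twice by maximality gives `b ≠ 0` with `φ b > 0` below which a vector
functional at some `x` dominates `φ`. An intertwiner then maps `b x` to `f b ξ`, whose inner product
with `ξ` has real part `φ b > 0`, a contradiction. -/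
theorem isTotal_intertwiners {f : A.Elt →⋆ₐ[ℂ] B.Elt} (hf : IsNormalMap f) :
    IsTotal (intertwiners f) := by
  refine isTotal_of_forall_inner fun ξ hξ => ?_
  by_contra hne
  have hadd : ∀ {x y : A.Elt}, x ≤ y ↔ 0 ≤ y - x := fun {x y} =>
    (sub_nonneg (a := y.1) (b := x.1)).symm
  set φ := vectorFunctional f ξ with hφ
  have hφn : IsNormalFunctional φ := isNormalFunctional_vectorFunctional hf ξ
  have hφ1 : 0 < φ 1 := by
    have := vectorFunctional_star_mul_self f ξ 1
    rw [star_one, one_mul, map_one f] at this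
    rw [hφ, this]
    have : ‖ξ‖ ≠ 0 := norm_ne_zero_iff.2 hne
    change 0 < ‖ξ‖ ^ 2
    positivity
  -- Removing a maximal `q` with `φ q ≤ 0` leaves `e = 1 - q`, below which `φ` is strictly positive
  -- on nonzero positive elements.
  obtain ⟨q, hq0, hq1, hq2, hqmax⟩ := exists_maximal_nonneg (g := 0 - φ)
    (IsNormalFunctional.sub (fun D s _ _ _ _ => tendsto_const_nhds) hφn) (e := 1)
    (zero_le_one (α := A.H →L[ℂ] A.H))
  set e := 1 - q with he
  have he0 : 0 ≤ e := hadd.1 hq1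
  have hφe : 0 < φ e := by
    have : φ e = φ 1 - φ q := map_sub _ _ _
    simp only [LinearMap.sub_apply, LinearMap.zero_apply] at hq2
    linarith
  -- a vector functional which is larger than `φ` at `e`
  obtain ⟨x, hx⟩ : ∃ x : A.H, φ e < vectorFunctional (StarAlgHom.id ℂ A.Elt) x e := by
    obtain ⟨r, hr, hre⟩ := exists_sqrt (a := e) he0
    have hrne : r.1 ≠ 0 := by
      intro h0
      have : r = 0 := Subtype.ext h0
      rw [← hre, this] at hφe
      simp at hφe
    obtain ⟨y, hy⟩ : ∃ y, r.1 y ≠ 0 := by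
      by_contra! h
      exact hrne (ContinuousLinearMap.ext h)
    have hy0 : 0 < ‖r.1 y‖ := norm_pos_iff.2 hy
    -- With this scaling the vector functional takes the value `(1 + φ e) ^ 2` at `e`.
    refine ⟨((1 + φ e) / ‖r.1 y‖ : ℝ) • y, ?_⟩
    have hvf : ∀ z, vectorFunctional (StarAlgHom.id ℂ A.Elt) z e = ‖r.1 z‖ ^ 2 := by
      intro z
      rw [← hre]
      nth_rw 1 [← hr]
      rw [vectorFunctional_star_mul_self]
      rfl
    rw [hvf]
    have h1 : r.1 (((1 + φ e) / ‖r.1 y‖ : ℝ) • y) = ((1 + φ e) / ‖r.1 y‖ : ℝ) • r.1 y :=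
      map_smul_of_tower _ _ _
    rw [h1, norm_smul, Real.norm_eq_abs, abs_of_pos (by positivity), div_mul_cancel₀ _ hy0.ne']
    nlinarith
  -- Below `b = e - a`, the functional of `x` strictly exceeds `φ` on nonzero positive elements; `b`
  -- is nonzero since at `e` itself `φ` is the smaller one.
  obtain ⟨a, ha0, ha1, ha2, hamax⟩ := exists_maximal_nonneg (hφn.sub
    (isNormalFunctional_vectorFunctional isNormalMap_id x)) he0
  set b := e - a with hb
  have hb0 : 0 ≤ b := hadd.1 ha1
  have hble : b ≤ e := hadd.2 (by rw [hb, sub_sub_cancel]; exact ha0)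
  have hbne : b ≠ 0 := by
    intro h
    rw [hb, sub_eq_zero] at h
    simp only [LinearMap.sub_apply, ← h] at ha2
    linarith
  have hφb : 0 < φ b := by
    by_contra! h
    exact hbne (hqmax b hb0 hble (by simpa using h))
  obtain ⟨r, hr, hrb⟩ := exists_sqrt (a := b) hb0
  -- For a contraction `m`, the element `star (m * r) * (m * r)` lies below `r * r = b`, so a
  -- failure of the estimate would contradict the maximality of `a`.
  have hest : ∀ m : A.Elt, ‖(f m).1 ((f r).1 ξ)‖ ≤ ‖m.1 (r.1 x)‖ := by
    refine norm_le_of_forall_norm_le_one fun m hm => ?_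
    by_contra! hlt
    have hφc : φ (star (m * r) * (m * r)) = ‖(f m).1 ((f r).1 ξ)‖ ^ 2 := by
      rw [hφ, vectorFunctional_star_mul_self, map_mul]; rfl
    have hωc : vectorFunctional (StarAlgHom.id ℂ A.Elt) x (star (m * r) * (m * r)) =
        ‖m.1 (r.1 x)‖ ^ 2 := by
      rw [vectorFunctional_star_mul_self]; rfl
    have hlt2 : ‖m.1 (r.1 x)‖ ^ 2 < ‖(f m).1 ((f r).1 ξ)‖ ^ 2 := by gcongr
    have hc : star (m * r) * (m * r) = 0 := by
      refine hamax _ ?_ ?_ ?_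
      · exact (star_mul_self_nonneg (m.1 * r.1) : 0 ≤ star (m.1 * r.1) * (m.1 * r.1))
      · rw [← hrb]
        refine le_iff_inner_le.2 (fun y => ?_ :
          ∀ y, ⟪(star (m.1 * r.1) * (m.1 * r.1)) y, y⟫_ℂ ≤ ⟪(r.1 * r.1) y, y⟫_ℂ)
        have hr' : star r.1 = r.1 := congrArg Subtype.val hr
        nth_rw 3 [← hr']
        simp only [mul_apply_eq_comp, star_eq_adjoint, adjoint_inner_left,
          inner_self_eq_norm_sq_to_K]
        have : ‖m.1 (r.1 y)‖ ≤ ‖r.1 y‖ :=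
          (m.1.le_opNorm _).trans (mul_le_of_le_one_left (norm_nonneg _) hm)
        norm_cast
        gcongr
      · rw [LinearMap.sub_apply, hφc, hωc]
        linarith
    rw [hc, map_zero] at hφc hωc
    linarith
  obtain ⟨T, hT, hTr⟩ := exists_intertwiner hest
  have hTb : T (b.1 x) = (f b).1 ξ := by
    rw [← hrb]
    refine (DFunLike.congr_fun (hT r) (r.1 x)).symm.trans ?_
    rw [map_mul]
    exact congrArg (f r).1 hTr
  have := hξ T hT (b.1 x)
  rw [hTb] at this
  have h2 : φ b = RCLike.re ⟪(f b).1 ξ, ξ⟫_ℂ := rfl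
  rw [h2, this] at hφb
  simp at hφb

end VNAlg

namespace VNAlg
variable {A B : VNAlg.{u}}

/-! ### Homomorphisms defined by intertwiners -/

theorem IsTotal.mono_left {H K : Type*} [NormedAddCommGroup H] [InnerProductSpace ℂ H]
    [NormedAddCommGroup K] [InnerProductSpace ℂ K] {𝓧 𝓨 : Set (H →L[ℂ] K)} (h : IsTotal 𝓧)
    (hle : ∀ X ∈ 𝓧, X ∈ 𝓨) : IsTotal 𝓨 :=
  h.mono (Submodule.span_mono (by rintro _ ⟨X, hX, hx⟩; exact ⟨X, hle X hX, hx⟩))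

theorem eq_of_inner_eq_of_denseRange {E H : Type*} [NormedAddCommGroup H] [InnerProductSpace ℂ H]
    {L : E → H} (hL : DenseRange L) {S T : H →L[ℂ] H}
    (h : ∀ x y, ⟪S (L x), L y⟫_ℂ = ⟪T (L x), L y⟫_ℂ) : S = T := by
  ext v
  refine ext_inner_right ℂ fun w => ?_
  refine hL.induction_on v (isClosed_eq (by fun_prop) (by fun_prop)) fun x => ?_
  exact hL.induction_on w (isClosed_eq (by fun_prop) (by fun_prop)) fun y => h x y

theorem inner_self_eq_ofReal {H : Type*} [NormedAddCommGroup H] [InnerProductSpace ℂ H] (x : H) :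
    ⟪x, x⟫_ℂ = ((‖x‖ ^ 2 : ℝ) : ℂ) := by
  rw [inner_self_eq_norm_sq_to_K, Complex.ofReal_pow]
  rfl

/-- This turns boundedness of an induced representation into algebra: `‖t‖ ^ 2 ‖v‖ ^ 2 - ‖t v‖ ^ 2`
becomes the square `‖r v‖ ^ 2`. -/
theorem exists_sqrt_norm_sq_sub (t : A.Elt) :
    ∃ r : A.Elt, star r * r = ((‖t.1‖ ^ 2 : ℝ) : ℂ) • (1 : A.Elt) - star t * t := by
  obtain ⟨r, hr, hrr⟩ := exists_sqrt (a := ((‖t.1‖ ^ 2 : ℝ) : ℂ) • (1 : A.Elt) - star t * t) (by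
    rw [nonneg_iff_inner_nonneg]
    intro x
    change 0 ≤ ⟪(((‖t.1‖ ^ 2 : ℝ) : ℂ) • (1 : A.H →L[ℂ] A.H) - star t.1 * t.1) x, x⟫_ℂ
    simp only [sub_apply, smul_apply, one_apply_eq_self, mul_apply_eq_comp, star_eq_adjoint,
      inner_sub_left, inner_smul_left, adjoint_inner_left, inner_self_eq_ofReal,
      Complex.conj_ofReal, sub_nonneg, ← Complex.ofReal_mul, Complex.real_le_real]
    rw [← mul_pow]
    gcongr
    exact t.1.le_opNorm x)
  exact ⟨r, by rw [hr, hrr]⟩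

section induced

variable {𝓧 : Set (A.H →L[ℂ] B.H)}

variable (𝓧) in
/-- `(ζ_X)_X ↦ ∑ X ζ_X` -/
def sumMap : (𝓧 →₀ A.H) →ₗ[ℂ] B.H := Finsupp.lsum ℂ fun X => (X.1 : A.H →ₗ[ℂ] B.H)

theorem sumMap_single (X : 𝓧) (x : A.H) : sumMap 𝓧 (Finsupp.single X x) = X.1 x := by
  simp [sumMap]

theorem denseRange_sumMap (h : IsTotal 𝓧) : DenseRange (sumMap 𝓧) := by
  have : (Submodule.span ℂ {y | ∃ X ∈ 𝓧, ∃ x, X x = y}) ≤ LinearMap.range (sumMap 𝓧) := by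
    rw [Submodule.span_le]
    rintro _ ⟨X, hX, x, rfl⟩
    exact ⟨Finsupp.single ⟨X, hX⟩ x, sumMap_single _ _⟩
  exact h.mono this

/-- The diagonal action of `t` on families of vectors. -/
def amplify (ι : Type*) (t : A.Elt) : (ι →₀ A.H) →ₗ[ℂ] (ι →₀ A.H) :=
  Finsupp.mapRange.linearMap (t.1 : A.H →ₗ[ℂ] A.H)

@[simp] theorem amplify_single {ι : Type*} (t : A.Elt) (i : ι) (x : A.H) :
    amplify ι t (Finsupp.single i x) = Finsupp.single i (t.1 x) := by
  simp [amplify]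

theorem amplify_mul {ι : Type*} (s t : A.Elt) (ζ : ι →₀ A.H) :
    amplify ι (s * t) ζ = amplify ι s (amplify ι t ζ) := by
  ext i; simp [amplify]

theorem amplify_add {ι : Type*} (s t : A.Elt) (ζ : ι →₀ A.H) :
    amplify ι (s + t) ζ = amplify ι s ζ + amplify ι t ζ := by
  ext i; simp [amplify]

theorem amplify_sub {ι : Type*} (s t : A.Elt) (ζ : ι →₀ A.H) :
    amplify ι (s - t) ζ = amplify ι s ζ - amplify ι t ζ := by
  ext i; simp [amplify]

theorem amplify_smul_one {ι : Type*} (c : ℂ) (ζ : ι →₀ A.H) :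
    amplify ι (c • (1 : A.Elt)) ζ = c • ζ := by
  ext i; simp [amplify]

theorem inner_sumMap_amplify {y : B.H →L[ℂ] B.H} {t : A.Elt}
    (h : ∀ X ∈ 𝓧, ∀ X' ∈ 𝓧, ∀ x x', ⟪y (X (t.1 x)), X' x'⟫_ℂ = ⟪y (X x), X' ((star t).1 x')⟫_ℂ)
    (ζ ζ' : 𝓧 →₀ A.H) : ⟪y (sumMap 𝓧 (amplify _ t ζ)), sumMap 𝓧 ζ'⟫_ℂ =
      ⟪y (sumMap 𝓧 ζ), sumMap 𝓧 (amplify _ (star t) ζ')⟫_ℂ := by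
  induction ζ using Finsupp.induction_linear with
  | zero => simp
  | add x y hx hy => simp only [map_add, inner_add_left, hx, hy]
  | single X x =>
    induction ζ' using Finsupp.induction_linear with
    | zero => simp
    | add x y hx hy => simp only [map_add, inner_add_right, hx, hy]
    | single X' x' =>
      simp only [amplify_single, sumMap_single]
      exact h X X.2 X' X'.2 x x'

/-- A total set of operators `X` with `X'† y X` in the commutant of `A` for all `y` in the
commutant of `B` induces a morphism `Φ` with `Φ t X = X t`. -/
theorem exists_hom_of_isTotal (htot : IsTotal 𝓧)
    (h : ∀ y ∈ B.algebra.commutant, ∀ X ∈ 𝓧, ∀ X' ∈ 𝓧, ∀ (t : A.Elt) (x x' : A.H),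
      ⟪y (X (t.1 x)), X' x'⟫_ℂ = ⟪y (X x), X' ((star t).1 x')⟫_ℂ) :
    ∃ Φ : A ⟶ B, ∀ X ∈ 𝓧, X ∈ intertwiners (ap Φ) := by
  have hL := denseRange_sumMap htot
  set L := sumMap 𝓧
  have hadj : ∀ y ∈ B.algebra.commutant, ∀ (t : A.Elt) (ζ ζ' : 𝓧 →₀ A.H),
      ⟪y (L (amplify _ t ζ)), L ζ'⟫_ℂ = ⟪y (L ζ), L (amplify _ (star t) ζ')⟫_ℂ :=
    fun y hy t => inner_sumMap_amplify fun X hX X' hX' => h y hy X hX X' hX' t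
  -- The case `y = 1` says that `t` and `star t` act as formal adjoints.
  have hadj1 : ∀ (t : A.Elt) (ζ ζ' : 𝓧 →₀ A.H),
      ⟪L (amplify _ t ζ), L ζ'⟫_ℂ = ⟪L ζ, L (amplify _ (star t) ζ')⟫_ℂ :=
    hadj 1 (one_mem B.algebra.commutant)
  have hnorm : ∀ (t : A.Elt) (ζ : 𝓧 →₀ A.H), ‖L (amplify _ t ζ)‖ ≤ ‖t.1‖ * ‖L ζ‖ := by
    intro t ζ
    obtain ⟨r, hr⟩ := exists_sqrt_norm_sq_sub t
    have h1 : ∀ s : A.Elt, ((‖L (amplify _ s ζ)‖ ^ 2 : ℝ) : ℂ) =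
        ⟪L ζ, L (amplify _ (star s * s) ζ)⟫_ℂ := by
      intro s
      rw [amplify_mul, ← hadj1, inner_self_eq_ofReal]
    have h2 := h1 r
    rw [hr, amplify_sub, map_sub, inner_sub_right, ← h1 t, amplify_smul_one, map_smul,
      inner_smul_right, inner_self_eq_ofReal] at h2
    norm_cast at h2
    refine le_of_sq_le_sq ?_ (by positivity)
    rw [mul_pow]
    linarith [sq_nonneg ‖L (amplify _ r ζ)‖]
  -- The estimate `hnorm` shows at once that `∑ X ζ_X ↦ ∑ X (t ζ_X)` is well defined and that it
  -- extends continuously.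
  let Φ₀ : A.Elt → B.H →L[ℂ] B.H := fun t => (L ∘ₗ amplify _ t).extendOfNorm L
  have hΦ₀ : ∀ t ζ, Φ₀ t (L ζ) = L (amplify _ t ζ) := fun t =>
    LinearMap.extendOfNorm_eq hL ⟨‖t.1‖, hnorm t⟩
  have hstar : ∀ t, Φ₀ (star t) = star (Φ₀ t) := by
    intro t
    refine eq_of_inner_eq_of_denseRange hL fun ζ ζ' => ?_
    rw [star_eq_adjoint, adjoint_inner_left, hΦ₀, hΦ₀, hadj1, star_star]
  -- For general `y` in the commutant of `B`, the hypothesis says that `Φ₀ t` commutes with `y`.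
  have hmem : ∀ t, Φ₀ t ∈ B.algebra := by
    intro t
    refine mem_of_forall_commute fun y hy => eq_of_inner_eq_of_denseRange hL fun ζ ζ' => ?_
    rw [mul_apply_eq_comp, mul_apply_eq_comp, hΦ₀, hadj y hy, ← hΦ₀, hstar, star_eq_adjoint,
      adjoint_inner_right]
  have hext : ∀ {S T : B.H →L[ℂ] B.H}, (∀ ζ, S (L ζ) = T (L ζ)) → S = T := fun hST =>
    eq_of_inner_eq_of_denseRange hL fun ζ _ => by rw [hST]
  let Φ : A.Elt →⋆ₐ[ℂ] B.Elt :=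
    { toFun := fun t => ⟨Φ₀ t, hmem t⟩
      map_one' := Subtype.ext (hext fun ζ => by
        rw [hΦ₀, ← one_smul ℂ (1 : A.Elt), amplify_smul_one, one_smul]; rfl)
      map_mul' := fun s t => Subtype.ext (hext fun ζ => by
        change _ = Φ₀ s (Φ₀ t (L ζ))
        rw [hΦ₀, hΦ₀, hΦ₀, amplify_mul])
      map_zero' := Subtype.ext (hext fun ζ => by
        rw [hΦ₀, ← zero_smul ℂ (1 : A.Elt), amplify_smul_one, zero_smul, map_zero]; rfl)
      map_add' := fun s t => Subtype.ext (hext fun ζ => by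
        change _ = Φ₀ s (L ζ) + Φ₀ t (L ζ)
        rw [hΦ₀, hΦ₀, hΦ₀, amplify_add, map_add])
      commutes' := fun c => Subtype.ext (hext fun ζ => by
        rw [hΦ₀, Algebra.algebraMap_eq_smul_one, amplify_smul_one, map_smul,
          Algebra.algebraMap_eq_smul_one]
        rfl)
      map_star' := fun t => Subtype.ext (hstar t) }
  have hX : ∀ X ∈ 𝓧, X ∈ intertwiners Φ := by
    intro X hX t
    ext x
    have := hΦ₀ t (Finsupp.single ⟨X, hX⟩ x)
    rwa [amplify_single, sumMap_single, sumMap_single] at this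
  exact ⟨Hom.mk Φ (isNormalMap_of_isTotal (htot.mono_left hX)), hX⟩

end induced

/-! ### Generating sets: existence and uniqueness of morphisms. -/

/-- An operator which commutes with `S` commutes with all of `A`. -/
def Generates (A : VNAlg.{u}) (S : Set A.Elt) : Prop :=
  ∀ c : A.H →L[ℂ] A.H, (∀ s ∈ S, c ∘L s.1 = s.1 ∘L c) → ∀ t : A.Elt, c ∘L t.1 = t.1 ∘L c

theorem generates_univ (A : VNAlg.{u}) : Generates A Set.univ :=
  fun _ h t => h t (Set.mem_univ t)

theorem adjoint_comp_intertwines {t : A.Elt} {u : B.Elt} {X : A.H →L[ℂ] B.H}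
    (h : X ∘L (star t).1 = (star u).1 ∘L X) : adjoint X ∘L u.1 = t.1 ∘L adjoint X := by
  have := congrArg adjoint h
  rw [adjoint_comp, adjoint_comp] at this
  change adjoint (adjoint t.1) ∘L _ = _ ∘L adjoint (adjoint u.1) at this
  rw [adjoint_adjoint, adjoint_adjoint] at this
  exact this.symm

/-- For `y` in the commutant of `B`, the operator `X'† y X` commutes with `S`: move `s` through `X`
as `s'`, past `y`, and back through `X'†` by the relation for `star s`. Hence it commutes with all
of `A`, as `exists_hom_of_isTotal` requires. -/
theorem exists_hom_of_generates {S : Set A.Elt} (hS : Generates A S) {𝓧 : Set (A.H →L[ℂ] B.H)}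
    (htot : IsTotal 𝓧) (h : ∀ s ∈ S, ∃ s' : B.Elt, ∀ X ∈ 𝓧, X ∘L s.1 = s'.1 ∘L X ∧
      X ∘L (star s).1 = (star s').1 ∘L X) :
    ∃ Φ : A ⟶ B, ∀ X ∈ 𝓧, X ∈ intertwiners (ap Φ) := by
  refine exists_hom_of_isTotal htot fun y hy X hX X' hX' t x x' => ?_
  have := hS (adjoint X' ∘L y ∘L X) (fun s hs => ?_) t
  · have h2 := congrArg (fun T => ⟪T x, x'⟫_ℂ) this
    change ⟪adjoint X' (y (X (t.1 x))), x'⟫_ℂ = ⟪t.1 (adjoint X' (y (X x))), x'⟫_ℂ at h2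
    rw [adjoint_inner_left] at h2
    rw [h2, ← adjoint_inner_left]
    exact (adjoint_inner_right _ _ _).symm
  · obtain ⟨s', hs'⟩ := h s hs
    have hy' : s'.1 ∘L y = y ∘L s'.1 := (VonNeumannAlgebra.mem_commutant_iff.1 hy) _ s'.2
    calc (adjoint X' ∘L y ∘L X) ∘L s.1 = adjoint X' ∘L y ∘L (X ∘L s.1) := rfl
      _ = adjoint X' ∘L (y ∘L s'.1) ∘L X := by rw [(hs' X hX).1]; rfl
      _ = (adjoint X' ∘L s'.1) ∘L y ∘L X := by rw [← hy']; rfl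
      _ = _ := by rw [adjoint_comp_intertwines (hs' X' hX').2]; rfl

/-- If `X` intertwines `f` and `Y` intertwines `g`, then `Y† X` commutes with `S`, hence with `A`.
So `Y† (f t) X = Y† X t = t Y† X = Y† (g t) X`, and totality of both families gives `f t = g t`. No
continuity argument on the span of `S` is needed. -/
theorem hom_ext_of_generates {S : Set A.Elt} (hS : Generates A S) {f g : A ⟶ B}
    (h : ∀ s ∈ S, ap f s = ap g s) : f = g := by
  refine hom_ext fun t => Subtype.ext ?_
  refine (isTotal_intertwiners (Hom.normal f)).ext fun X hX => ?_
  have hY : ∀ Y ∈ intertwiners (ap g), adjoint Y ∘L (ap f t).1 ∘L X =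
      adjoint Y ∘L (ap g t).1 ∘L X := by
    intro Y hY
    have hY' : ∀ s, adjoint Y ∘L (ap g s).1 = s.1 ∘L adjoint Y := fun s =>
      adjoint_comp_intertwines (by rw [← map_star]; exact (hY _).symm)
    have := hS (adjoint Y ∘L X) (fun s hs => ?_) t
    · calc adjoint Y ∘L (ap f t).1 ∘L X = (adjoint Y ∘L X) ∘L t.1 := by
            rw [show (ap f t).1 ∘L X = X ∘L t.1 from hX t]; rfl
        _ = t.1 ∘L (adjoint Y ∘L X) := this
        _ = (t.1 ∘L adjoint Y) ∘L X := rfl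
        _ = _ := by rw [← hY' t]; rfl
    · calc (adjoint Y ∘L X) ∘L s.1 = adjoint Y ∘L (X ∘L s.1) := rfl
        _ = (adjoint Y ∘L (ap f s).1) ∘L X := by rw [← hX s]; rfl
        _ = _ := by rw [h s hs, hY' s]; rfl
  ext x
  refine ext_inner_right ℂ fun v => ?_
  have := (isTotal_intertwiners (Hom.normal g)).ext
    (S := innerSL ℂ (((ap f t).1 ∘L X) x)) (T := innerSL ℂ (((ap g t).1 ∘L X) x)) fun Y hY' => by
      ext z
      have h2 := congrArg (fun T => ⟪T x, z⟫_ℂ) (hY Y hY')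
      change ⟪adjoint Y (((ap f t).1 ∘L X) x), z⟫_ℂ = ⟪adjoint Y (((ap g t).1 ∘L X) x), z⟫_ℂ at h2
      rwa [adjoint_inner_left, adjoint_inner_left] at h2
  exact DFunLike.congr_fun this v

end VNAlg

namespace VNAlg

/-! ### The Hilbert space tensor product -/

variable {A B C D : VNAlg.{u}}

/-- The vector `x ⊗ y`, continuous in `y`. -/
def ptL (B : VNAlg.{u}) (x : A.H) : B.H →L[ℂ] (tensor A B).H :=
  (UniformSpace.Completion.toComplL : A.H ⊗[ℂ] B.H →L[ℂ] UniformSpace.Completion (A.H ⊗[ℂ] B.H)) ∘L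
    TensorProduct.mkL ℂ A.H B.H x

/-- The vector `x ⊗ y`, continuous in `x`. -/
def ptR (A : VNAlg.{u}) (y : B.H) : A.H →L[ℂ] (tensor A B).H :=
  (UniformSpace.Completion.toComplL : A.H ⊗[ℂ] B.H →L[ℂ] UniformSpace.Completion (A.H ⊗[ℂ] B.H)) ∘L
    (TensorProduct.mkL ℂ A.H B.H).flip y

/-- The vector `x ⊗ y`. -/
def pt (x : A.H) (y : B.H) : (tensor A B).H := ptL B x y

theorem ptL_apply (x : A.H) (y : B.H) : ptL B x y = pt x y := rfl

theorem ptR_apply (x : A.H) (y : B.H) : ptR A y x = pt x y := rfl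

theorem pt_add_left (x x' : A.H) (y : B.H) : pt (x + x') y = pt x y + pt x' y :=
  map_add (ptR A y) x x'

theorem pt_add_right (x : A.H) (y y' : B.H) : pt x (y + y') = pt x y + pt x y' :=
  map_add (ptL B x) y y'

theorem pt_smul_left (c : ℂ) (x : A.H) (y : B.H) : pt (c • x) y = c • pt x y :=
  map_smul (ptR A y) c x

theorem pt_smul_right (c : ℂ) (x : A.H) (y : B.H) : pt x (c • y) = c • pt x y :=
  map_smul (ptL B x) c y

theorem inner_pt (x x' : A.H) (y y' : B.H) :
    ⟪pt x y, pt x' y'⟫_ℂ = ⟪x, x'⟫_ℂ * ⟪y, y'⟫_ℂ :=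
  (UniformSpace.Completion.inner_coe (𝕜 := ℂ) (x ⊗ₜ[ℂ] y : A.H ⊗[ℂ] B.H) (x' ⊗ₜ y')).trans
    (TensorProduct.inner_tmul ..)

theorem tmul_pt (a : A.Elt) (b : B.Elt) (x : A.H) (y : B.H) :
    (tmul a b).1 (pt x y) = pt (a.1 x) (b.1 y) := tmul_apply a b x y

/-- Elementary tensors as elements of the algebraic tensor product. -/
def ofTensor (A B : VNAlg.{u}) : A.H ⊗[ℂ] B.H →ₗ[ℂ] (tensor A B).H :=
  (UniformSpace.Completion.toComplL :
    A.H ⊗[ℂ] B.H →L[ℂ] UniformSpace.Completion (A.H ⊗[ℂ] B.H)).toLinearMap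

theorem ofTensor_tmul (x : A.H) (y : B.H) : ofTensor A B (x ⊗ₜ y) = pt x y := rfl

theorem denseRange_ofTensor : DenseRange (ofTensor A B) :=
  UniformSpace.Completion.denseRange_coe

theorem norm_ofTensor (z : A.H ⊗[ℂ] B.H) : ‖ofTensor A B z‖ = ‖z‖ :=
  UniformSpace.Completion.norm_coe z

theorem op_ext {L : Type*} [NormedAddCommGroup L] [InnerProductSpace ℂ L]
    {S T : (tensor A B).H →L[ℂ] L} (h : ∀ x y, S (pt x y) = T (pt x y)) : S = T := by
  ext v
  refine denseRange_ofTensor.induction_on v (isClosed_eq (by fun_prop) (by fun_prop)) fun z => ?_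
  induction z with
  | zero => simp
  | add x y hx hy => simp only [map_add, hx, hy]
  | tmul x y => exact h x y

theorem eq_zero_of_inner_pt {v : (tensor A B).H} (h : ∀ x y, ⟪pt x y, v⟫_ℂ = 0) : v = 0 := by
  have : innerSL ℂ v = 0 := op_ext fun x y => by
    simpa using inner_eq_zero_symm.1 (h x y)
  simpa using DFunLike.congr_fun this v

/-- `S ⊗ T` for bounded operators. -/
def mapOp (S : A.H →L[ℂ] C.H) (T : B.H →L[ℂ] D.H) : (tensor A B).H →L[ℂ] (tensor C D).H :=
  (TensorProduct.mapL S T).completion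

theorem mapOp_pt (S : A.H →L[ℂ] C.H) (T : B.H →L[ℂ] D.H) (x : A.H) (y : B.H) :
    mapOp S T (pt x y) = pt (S x) (T y) :=
  ContinuousLinearMap.completion_apply_coe _ _

/-- A bilinear map which preserves the inner products of elementary tensors extends to the Hilbert
space tensor product. -/
theorem exists_lift {L : Type*} [NormedAddCommGroup L] [InnerProductSpace ℂ L] [CompleteSpace L]
    (b : A.H →ₗ[ℂ] B.H →ₗ[ℂ] L)
    (hb : ∀ x y x' y', ⟪b x y, b x' y'⟫_ℂ = ⟪x, x'⟫_ℂ * ⟪y, y'⟫_ℂ) :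
    ∃ U : (tensor A B).H →L[ℂ] L, ∀ x y, U (pt x y) = b x y := by
  have hinner : ∀ z w, ⟪TensorProduct.lift b z, TensorProduct.lift b w⟫_ℂ = ⟪z, w⟫_ℂ := by
    intro z w
    induction z with
    | zero => simp
    | add x y hx hy => simp only [map_add, inner_add_left, hx, hy]
    | tmul x y =>
      induction w with
      | zero => simp
      | add x y hx hy => simp only [map_add, inner_add_right, hx, hy]
      | tmul x' y' => simp [hb]
  have hnorm : ∀ z, ‖TensorProduct.lift b z‖ ≤ 1 * ‖ofTensor A B z‖ := by
    intro z
    rw [one_mul, norm_ofTensor, @norm_eq_sqrt_re_inner ℂ, @norm_eq_sqrt_re_inner ℂ _ _ _ _ z,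
      hinner]
  refine ⟨(TensorProduct.lift b).extendOfNorm (ofTensor A B), fun x y => ?_⟩
  have := LinearMap.extendOfNorm_eq (denseRange_ofTensor (A := A) (B := B)) ⟨1, hnorm⟩ (x ⊗ₜ y)
  rwa [ofTensor_tmul, TensorProduct.lift.tmul] at this

theorem isTotal_ptR : IsTotal (Set.range (ptR A : B.H → _)) :=
  isTotal_of_forall_inner fun _ hv => eq_zero_of_inner_pt fun x y => hv _ ⟨y, rfl⟩ x

theorem isTotal_ptL : IsTotal (Set.range (ptL B : A.H → _)) :=
  isTotal_of_forall_inner fun _ hv => eq_zero_of_inner_pt fun x y => hv _ ⟨x, rfl⟩ y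

/-- A vector orthogonal to all `X x ⊗ Y y` is orthogonal to `X x ⊗ w` for every `w` by totality of
`𝓨`, and then to every `u ⊗ w` by totality of `𝓧`. -/
theorem IsTotal.mapOp {𝓧 : Set (A.H →L[ℂ] C.H)} {𝓨 : Set (B.H →L[ℂ] D.H)} (hX : IsTotal 𝓧)
    (hY : IsTotal 𝓨) : IsTotal {Z | ∃ X ∈ 𝓧, ∃ Y ∈ 𝓨, mapOp X Y = Z} := by
  refine isTotal_of_forall_inner fun v hv => eq_zero_of_inner_pt fun u w => ?_
  refine inner_eq_zero_symm.1 ?_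
  have h1 : ∀ X ∈ 𝓧, ∀ x, innerSL ℂ v ∘L ptL D (X x) = 0 := by
    intro X hX x
    refine hY.ext fun Y hY => ?_
    ext y
    have := inner_eq_zero_symm.1 (hv _ ⟨X, hX, Y, hY, rfl⟩ (pt x y))
    rwa [mapOp_pt] at this
  have h2 : innerSL ℂ v ∘L ptR C w = 0 := by
    refine hX.ext fun X hX => ?_
    ext x
    exact DFunLike.congr_fun (h1 X hX x) w
  exact DFunLike.congr_fun h2 u

/-! ### Morphisms out of a spatial tensor product -/

theorem elt_tensor_ext {s t : (tensor A B).Elt} (h : ∀ x y, s.1 (pt x y) = t.1 (pt x y)) :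
    s = t := Subtype.ext (op_ext h)

theorem tmul_mul_tmul (a a' : A.Elt) (b b' : B.Elt) :
    tmul a b * tmul a' b' = tmul (a * a') (b * b') := by
  refine elt_tensor_ext fun x y => ?_
  change (tmul a b).1 ((tmul a' b').1 _) = _
  simp only [tmul_pt]
  rfl

theorem star_tmul (a : A.Elt) (b : B.Elt) : star (tmul a b) = tmul (star a) (star b) := by
  refine elt_tensor_ext fun x y => ?_
  rw [← sub_eq_zero]
  refine eq_zero_of_inner_pt fun x' y' => ?_
  change ⟪_, adjoint (tmul a b).1 _ - _⟫_ℂ = 0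
  rw [inner_sub_right, adjoint_inner_right, tmul_pt, tmul_pt, inner_pt, inner_pt, sub_eq_zero]
  change _ = ⟪_, adjoint a.1 x⟫_ℂ * ⟪_, adjoint b.1 y⟫_ℂ
  rw [adjoint_inner_right, adjoint_inner_right]

theorem tmul_one_one : tmul (1 : A.Elt) (1 : B.Elt) = 1 :=
  elt_tensor_ext fun x y => tmul_pt _ _ x y

/-- The tensor product is a bicommutant, with centralizers that also involve adjoints; these add no
condition since `star (a ⊗ b)` is again elementary. -/
theorem generates_tmul : Generates (tensor A B) {t | ∃ a b, tmul a b = t} := by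
  intro c hc t
  have ht : t.1 ∈ StarSubalgebra.centralizer ℂ (StarSubalgebra.centralizer ℂ
      {t : (tensor A B).H →L[ℂ] (tensor A B).H | ∃ a ∈ A.algebra, ∃ b ∈ B.algebra,
        t = (TensorProduct.mapL a b).completion} :
          Set ((tensor A B).H →L[ℂ] (tensor A B).H)) := t.2
  rw [StarSubalgebra.mem_centralizer_iff] at ht
  refine (ht c ?_).1
  rw [SetLike.mem_coe, StarSubalgebra.mem_centralizer_iff]
  rintro _ ⟨a, ha, b, hb, rfl⟩
  constructor
  · exact (hc _ ⟨⟨a, ha⟩, ⟨b, hb⟩, rfl⟩).symm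
  · have := hc _ ⟨star ⟨a, ha⟩, star ⟨b, hb⟩, rfl⟩
    rw [← star_tmul] at this
    exact this.symm

theorem tensor_hom_ext {f g : tensor A B ⟶ C}
    (h : ∀ a b, ap f (tmul a b) = ap g (tmul a b)) : f = g :=
  hom_ext_of_generates generates_tmul (by rintro _ ⟨a, b, rfl⟩; exact h a b)

/-- The images of `f` and `g` need not be assumed to commute. The operators in `𝓧` carry `a ⊗ b` to
the product in either order, and the reversed order is the one needed for adjoints. -/
theorem exists_tensor_desc (f : A ⟶ C) (g : B ⟶ C) {𝓧 : Set ((tensor A B).H →L[ℂ] C.H)}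
    (htot : IsTotal 𝓧)
    (hf : ∀ X ∈ 𝓧, ∀ (a : A.Elt) x y, X (pt (a.1 x) y) = (ap f a).1 (X (pt x y)))
    (hg : ∀ X ∈ 𝓧, ∀ (b : B.Elt) x y, X (pt x (b.1 y)) = (ap g b).1 (X (pt x y))) :
    ∃ Φ : tensor A B ⟶ C, (∀ a b, ap Φ (tmul a b) = ap f a * ap g b) ∧
      ∀ X ∈ 𝓧, X ∈ intertwiners (ap Φ) := by
  have key : ∀ X ∈ 𝓧, ∀ a b, X ∘L (tmul a b).1 = (ap f a * ap g b).1 ∘L X := by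
    intro X hX a b
    refine op_ext fun x y => ?_
    change X ((tmul a b).1 _) = (ap f a).1 ((ap g b).1 (X _))
    rw [tmul_pt, hf X hX, hg X hX]
  have key' : ∀ X ∈ 𝓧, ∀ a b, X ∘L (tmul a b).1 = (ap g b * ap f a).1 ∘L X := by
    intro X hX a b
    refine op_ext fun x y => ?_
    change X ((tmul a b).1 _) = (ap g b).1 ((ap f a).1 (X _))
    rw [tmul_pt, hg X hX, hf X hX]
  obtain ⟨Φ, hΦ⟩ := exists_hom_of_generates (B := C) generates_tmul htot (by
    rintro _ ⟨a, b, rfl⟩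
    refine ⟨ap f a * ap g b, fun X hX => ⟨key X hX a b, ?_⟩⟩
    rw [star_tmul, star_mul, ← map_star, ← map_star]
    exact key' X hX _ _)
  refine ⟨Φ, fun a b => Subtype.ext (htot.ext fun X hX => ?_), hΦ⟩
  rw [← key X hX a b]
  exact hΦ X hX _

/-- The operators `x ↦ x ⊗ y` carry `a` to `a ⊗ 1`, and they are total. -/
theorem exists_inl (A B : VNAlg.{u}) : ∃ f : A ⟶ tensor A B, ∀ a, ap f a = tmul a 1 := by
  have key : ∀ X ∈ Set.range (ptR A : B.H → _), ∀ a : A.Elt,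
      X ∘L a.1 = (tmul a (1 : B.Elt)).1 ∘L X := by
    rintro _ ⟨y, rfl⟩ a
    ext x
    exact (tmul_pt a 1 x y).symm
  obtain ⟨Φ, hΦ⟩ := exists_hom_of_generates (B := tensor A B) (generates_univ A) isTotal_ptR (by
    intro a _
    refine ⟨tmul a 1, fun X hX => ⟨key X hX a, ?_⟩⟩
    rw [star_tmul, star_one]
    exact key X hX _)
  refine ⟨Φ, fun a => Subtype.ext (isTotal_ptR.ext fun X hX => ?_)⟩
  rw [← key X hX a]
  exact hΦ X hX _

theorem exists_inr (A B : VNAlg.{u}) : ∃ f : B ⟶ tensor A B, ∀ b, ap f b = tmul 1 b := by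
  have key : ∀ X ∈ Set.range (ptL B : A.H → _), ∀ b : B.Elt,
      X ∘L b.1 = (tmul (1 : A.Elt) b).1 ∘L X := by
    rintro _ ⟨x, rfl⟩ b
    ext y
    exact (tmul_pt 1 b x y).symm
  obtain ⟨Φ, hΦ⟩ := exists_hom_of_generates (B := tensor A B) (generates_univ B) isTotal_ptL (by
    intro b _
    refine ⟨tmul 1 b, fun X hX => ⟨key X hX b, ?_⟩⟩
    rw [star_tmul, star_one]
    exact key X hX _)
  refine ⟨Φ, fun b => Subtype.ext (isTotal_ptL.ext fun X hX => ?_)⟩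
  rw [← key X hX b]
  exact hΦ X hX _

/-- The morphism `a ↦ a ⊗ 1`. -/
def inl (A B : VNAlg.{u}) : A ⟶ tensor A B := (exists_inl A B).choose

@[simp] theorem ap_inl (a : A.Elt) : ap (inl A B) a = tmul a 1 := (exists_inl A B).choose_spec a

/-- The morphism `b ↦ 1 ⊗ b`. -/
def inr (A B : VNAlg.{u}) : B ⟶ tensor A B := (exists_inr A B).choose

@[simp] theorem ap_inr (b : B.Elt) : ap (inr A B) b = tmul 1 b := (exists_inr A B).choose_spec b

theorem ap_tmul (f : tensor A B ⟶ C) (a : A.Elt) (b : B.Elt) :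
    ap f (tmul a b) = ap (inl A B ≫ f) a * ap (inr A B ≫ f) b := by
  rw [ap_comp, ap_comp, ap_inl, ap_inr, ← map_mul, tmul_mul_tmul, mul_one, one_mul]

/-- Since `a ⊗ b = (a ⊗ 1) (1 ⊗ b)`, the two restrictions suffice. For iterated tensor products this
reduces equalities of morphisms to smaller sources. -/
theorem tensor_hom_ext_inl_inr {f g : tensor A B ⟶ C} (h₁ : inl A B ≫ f = inl A B ≫ g)
    (h₂ : inr A B ≫ f = inr A B ≫ g) : f = g :=
  tensor_hom_ext fun a b => by rw [ap_tmul, ap_tmul, h₁, h₂]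

end VNAlg

namespace VNAlg
variable {A B C D : VNAlg.{u}}

/-! ### Existence of the structure morphisms -/

/-- The operators `X ⊗ Y`, with `X` and `Y` intertwining `f` and `g`, are total by the normality of
`f` and `g`. -/
theorem exists_map (f : A ⟶ C) (g : B ⟶ D) : ∃ Φ : tensor A B ⟶ tensor C D,
    ∀ a b, ap Φ (tmul a b) = tmul (ap f a) (ap g b) := by
  obtain ⟨Φ, hΦ, -⟩ := exists_tensor_desc (f ≫ inl C D) (g ≫ inr C D)
    ((isTotal_intertwiners (Hom.normal f)).mapOp (isTotal_intertwiners (Hom.normal g)))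
    (by
      rintro _ ⟨X, hX, Y, hY, rfl⟩ a x y
      rw [ap_comp, ap_inl, mapOp_pt, mapOp_pt, tmul_pt]
      exact congrArg (fun v => pt v _) (DFunLike.congr_fun (hX a) x).symm)
    (by
      rintro _ ⟨X, hX, Y, hY, rfl⟩ b x y
      rw [ap_comp, ap_inr, mapOp_pt, mapOp_pt, tmul_pt]
      exact congrArg (fun v => pt _ v) (DFunLike.congr_fun (hY b) y).symm)
  exact ⟨Φ, fun a b => by
    rw [hΦ, ap_comp, ap_comp, ap_inl, ap_inr, tmul_mul_tmul, mul_one, one_mul]⟩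

/-- The flip of the Hilbert spaces alone is a total family. -/
theorem exists_braid (A B : VNAlg.{u}) : ∃ Φ : tensor A B ⟶ tensor B A,
    ∀ a b, ap Φ (tmul a b) = tmul b a := by
  obtain ⟨U, hU⟩ := exists_lift (A := A) (B := B) (L := (tensor B A).H)
    (LinearMap.mk₂ ℂ (fun x y => pt y x) (fun _ _ _ => pt_add_right _ _ _)
      (fun _ _ _ => pt_smul_right _ _ _) (fun _ _ _ => pt_add_left _ _ _)
      (fun _ _ _ => pt_smul_left _ _ _)) (fun x y x' y' => by
        rw [LinearMap.mk₂_apply, LinearMap.mk₂_apply, inner_pt, mul_comm])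
  simp only [LinearMap.mk₂_apply] at hU
  obtain ⟨Φ, hΦ, -⟩ := exists_tensor_desc (inr B A) (inl B A) (𝓧 := {U})
    (isTotal_of_forall_inner fun v hv => eq_zero_of_inner_pt fun x y => by
      rw [← hU]; exact hv U rfl _)
    (by
      rintro _ rfl a x y
      rw [ap_inr, hU, hU, tmul_pt]; rfl)
    (by
      rintro _ rfl a x y
      rw [ap_inl, hU, hU, tmul_pt]; rfl)
  exact ⟨Φ, fun a b => by
    rw [hΦ, ap_inl, ap_inr, tmul_mul_tmul, mul_one, one_mul]⟩

/-- This lets the Hilbert space associator be defined by `exists_lift`. One factor there is an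
arbitrary vector of a completed tensor product, so the identity on elementary tensors is extended in
one argument at a time. -/
theorem inner_mapOp_ptR (x x' : B.H) (w w' : (tensor A C).H) :
    ⟪mapOp (.id ℂ A.H) (ptR C x) w, mapOp (.id ℂ A.H) (ptR C x') w'⟫_ℂ =
      ⟪w, w'⟫_ℂ * ⟪x, x'⟫_ℂ := by
  have h1 : ∀ y z, innerSL ℂ (mapOp (.id ℂ A.H) (ptR C x) (pt y z)) ∘L
      mapOp (.id ℂ A.H) (ptR C x') = ⟪x, x'⟫_ℂ • innerSL ℂ (pt y z) := by
    intro y z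
    refine op_ext fun y' z' => ?_
    simp only [ContinuousLinearMap.comp_apply, mapOp_pt, ptR_apply, innerSL_apply_apply, smul_apply,
      inner_pt, smul_eq_mul]
    simp only [ContinuousLinearMap.id_apply]
    ring
  have h2 : innerSL ℂ (mapOp (.id ℂ A.H) (ptR C x') w') ∘L mapOp (.id ℂ A.H) (ptR C x) =
      ⟪x', x⟫_ℂ • innerSL ℂ w' := by
    refine op_ext fun y z => ?_
    have := DFunLike.congr_fun (h1 y z) w'
    simp only [ContinuousLinearMap.comp_apply, innerSL_apply_apply, smul_apply,
      smul_eq_mul] at this ⊢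
    rw [← inner_conj_symm, this, map_mul, inner_conj_symm, inner_conj_symm]
  have := DFunLike.congr_fun h2 w
  simp only [ContinuousLinearMap.comp_apply, innerSL_apply_apply, smul_apply, smul_eq_mul] at this
  rw [← inner_conj_symm, this, map_mul, inner_conj_symm, inner_conj_symm, mul_comm]

/-- The construction `exists_tensor_desc` is used twice. The operators `x ⊗ y ↦ x ⊗ (y ⊗ z)`, for
all `z`, give `Ψ` with `Ψ (a ⊗ b) = a ⊗ (b ⊗ 1)`. They assemble into the associator `U` of Hilbert
spaces, which combines `Ψ` with `c ↦ 1 ⊗ (1 ⊗ c)`. -/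
theorem exists_assoc (A B C : VNAlg.{u}) : ∃ Φ : tensor (tensor A B) C ⟶ tensor A (tensor B C),
    ∀ a b c, ap Φ (tmul (tmul a b) c) = tmul a (tmul b c) := by
  have heq : ∀ z (x : A.H) (y : B.H),
      mapOp (.id ℂ A.H) (ptR B (z : C.H)) (pt x y) = pt x (pt y z) :=
    fun z x y => mapOp_pt _ _ x y
  obtain ⟨Ψ, hΨ, hΨX⟩ := exists_tensor_desc (inl A (tensor B C)) (inl B C ≫ inr A (tensor B C))
    (𝓧 := Set.range fun z : C.H => mapOp (.id ℂ A.H) (ptR B z))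
    (by
      refine isTotal_of_forall_inner fun v hv => eq_zero_of_inner_pt fun x w => ?_
      have : innerSL ℂ v ∘L ptL (tensor B C) x = 0 := op_ext fun y z => by
        have := hv _ ⟨z, rfl⟩ (pt x y)
        dsimp only at this
        rw [heq] at this
        simpa [ptL_apply] using inner_eq_zero_symm.1 this
      exact inner_eq_zero_symm.1 (DFunLike.congr_fun this w))
    (by
      rintro _ ⟨z, rfl⟩ a x y
      dsimp only
      rw [ap_inl, heq, heq, tmul_pt]; rfl)
    (by
      rintro _ ⟨z, rfl⟩ b x y
      dsimp only
      rw [ap_comp, ap_inl, ap_inr, heq, heq, tmul_pt, tmul_pt]; rfl)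
  have hadd : ∀ z z', mapOp (.id ℂ A.H) (ptR B (z + z' : C.H)) =
      mapOp (.id ℂ A.H) (ptR B z) + mapOp (.id ℂ A.H) (ptR B z') := fun z z' =>
    op_ext fun x y => by
      rw [add_apply, heq, heq, heq, pt_add_right, pt_add_right]
  have hsmul : ∀ (c : ℂ) z, mapOp (.id ℂ A.H) (ptR B (c • z : C.H)) =
      c • mapOp (.id ℂ A.H) (ptR B z) := fun z z' =>
    op_ext fun x y => by
      rw [smul_apply, heq, heq, pt_smul_right, pt_smul_right]
  obtain ⟨U, hU⟩ := exists_lift (A := tensor A B) (B := C) (L := (tensor A (tensor B C)).H)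
    (LinearMap.mk₂ ℂ (fun w z => mapOp (.id ℂ A.H) (ptR B z) w) (fun _ _ _ => map_add _ _ _)
      (fun _ _ _ => map_smul _ _ _) (fun _ _ _ => by rw [hadd]; rfl)
      (fun _ _ _ => by rw [hsmul]; rfl)) (fun w z w' z' => inner_mapOp_ptR _ _ _ _)
  simp only [LinearMap.mk₂_apply] at hU
  obtain ⟨Φ, hΦ, -⟩ := exists_tensor_desc Ψ (inr B C ≫ inr A (tensor B C)) (𝓧 := {U})
    (by
      refine isTotal_of_forall_inner fun v hv => eq_zero_of_inner_pt fun x w => ?_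
      have : innerSL ℂ v ∘L ptL (tensor B C) x = 0 := op_ext fun y z => by
        have := hv _ rfl (pt (pt x y) z)
        rw [hU, heq] at this
        simpa [ptL_apply] using inner_eq_zero_symm.1 this
      exact inner_eq_zero_symm.1 (DFunLike.congr_fun this w))
    (by
      rintro _ rfl t w z
      rw [hU, hU]
      exact (DFunLike.congr_fun (hΨX _ ⟨z, rfl⟩ t) w).symm)
    (by
      rintro _ rfl c w z
      rw [hU, hU]
      refine DFunLike.congr_fun (op_ext (S := mapOp (.id ℂ A.H) (ptR B (c.1 z)))
        (T := (ap (inr B C ≫ inr A (tensor B C)) c).1 ∘L mapOp (.id ℂ A.H) (ptR B z))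
        fun x y => ?_) w
      rw [ContinuousLinearMap.comp_apply, ap_comp, ap_inr, ap_inr, heq, heq, tmul_pt, tmul_pt]
      rfl)
  refine ⟨Φ, fun a b c => ?_⟩
  rw [hΦ, hΨ]
  simp only [ap_comp, ap_inl, ap_inr, tmul_mul_tmul, mul_one, one_mul]

/-! ### The unit object and the left unitor. -/

/-- A unit vector of the Hilbert space of `unit`. -/
def unitVector : unit.{u}.H := EuclideanSpace.single PUnit.unit (1 : ℂ)

theorem eq_smul_unitVector (ζ : unit.{u}.H) : ζ = ⟪unitVector, ζ⟫_ℂ • unitVector.{u} := by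
  have key : ∀ z : EuclideanSpace ℂ PUnit.{u + 1}, z =
      ⟪EuclideanSpace.single PUnit.unit (1 : ℂ), z⟫_ℂ •
        EuclideanSpace.single PUnit.unit (1 : ℂ) := by
    intro z
    ext i
    simp [EuclideanSpace.inner_single_left]
  exact key ζ

theorem exists_eq_algebraMap (z : unit.{u}.Elt) : ∃ c : ℂ, z = algebraMap ℂ unit.{u}.Elt c := by
  refine ⟨⟪unitVector, z.1 unitVector⟫_ℂ, Subtype.ext ?_⟩
  ext ζ
  change z.1 ζ = ⟪unitVector, z.1 unitVector⟫_ℂ • ζ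
  have h := eq_smul_unitVector (z.1 unitVector)
  rw [eq_smul_unitVector ζ, map_smul, smul_comm, ← h]

theorem generates_empty (h : ∀ t : A.Elt, ∃ c : ℂ, t = algebraMap ℂ A.Elt c) :
    Generates A ∅ := by
  intro c _ t
  obtain ⟨z, rfl⟩ := h t
  ext x
  exact map_smul c z x

theorem generates_unit : Generates unit.{u} ∅ := generates_empty exists_eq_algebraMap

theorem unit_hom_ext {f g : unit.{u} ⟶ A} : f = g :=
  hom_ext_of_generates generates_unit (by simp)

theorem inner_unitVector : ⟪unitVector.{u}, unitVector.{u}⟫_ℂ = 1 := by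
  change ⟪EuclideanSpace.single PUnit.unit (1 : ℂ), EuclideanSpace.single PUnit.unit (1 : ℂ)⟫_ℂ = 1
  simp

theorem unitVector_ne_zero : unitVector.{u} ≠ 0 := fun h => by
  simpa [h] using inner_unitVector.{u}

/-- As the scalars are generated by the empty set, any total set of operators will do; here they are
of the form `ζ ↦ ⟪e, ζ⟫ x` with `e` the unit vector. -/
theorem exists_unit_hom (A : VNAlg.{u}) : Nonempty (unit ⟶ A) := by
  obtain ⟨Φ, -⟩ := exists_hom_of_generates (B := A) generates_unit
    (𝓧 := Set.range fun x : A.H => (innerSL ℂ unitVector).smulRight x)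
    (isTotal_of_forall_inner fun v hv => by
      have := hv _ ⟨v, rfl⟩ unitVector
      simpa [inner_unitVector, unitVector_ne_zero] using this) (by simp)
  exact ⟨Φ⟩

/-- The inclusion of the scalars. -/
def fromUnit (A : VNAlg.{u}) : unit ⟶ A := (exists_unit_hom A).some

theorem ap_algebraMap (f : A ⟶ B) (c : ℂ) : ap f (algebraMap ℂ A.Elt c) = algebraMap ℂ B.Elt c :=
  AlgHomClass.commutes (ap f) c

/-- The implementing operator is `ζ ⊗ x ↦ ⟪e, ζ⟫ x`, obtained as the adjoint of `x ↦ e ⊗ x`. -/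
theorem exists_lid (A : VNAlg.{u}) : ∃ Φ : tensor unit A ⟶ A,
    ∀ (z : ℂ) (a : A.Elt), ap Φ (tmul (algebraMap ℂ unit.Elt z) a) = z • a := by
  have hX : ∀ (ζ : unit.{u}.H) (x : A.H), adjoint (ptL A unitVector) (pt ζ x) =
      ⟪unitVector, ζ⟫_ℂ • x := by
    intro ζ x
    refine ext_inner_left ℂ fun v => ?_
    rw [adjoint_inner_right, ptL_apply, inner_pt, inner_smul_right]
  obtain ⟨Φ, hΦ, -⟩ := exists_tensor_desc (fromUnit A) (𝟙 A)
    (𝓧 := {adjoint (ptL A unitVector)})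
    (isTotal_of_forall_inner fun v hv => by
      have := hv _ rfl (pt unitVector v)
      simpa [hX, inner_unitVector, unitVector_ne_zero] using this)
    (by
      rintro _ rfl z ζ x
      obtain ⟨c, rfl⟩ := exists_eq_algebraMap z
      rw [ap_algebraMap]
      change adjoint (ptL A unitVector) (pt (c • ζ) x) = c • _
      rw [pt_smul_left, map_smul]
      rfl)
    (by
      rintro _ rfl a ζ x
      rw [hX, hX, ap_id, map_smul])
  exact ⟨Φ, fun z a => by rw [hΦ, ap_algebraMap, ap_id, Algebra.smul_def]⟩

end VNAlg

namespace VNAlg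
variable {A B C D : VNAlg.{u}}

/-! ### Coherence -/

theorem tensor_hom_ext_assoc {X : VNAlg.{u}} {f g : tensor (tensor A B) C ⟶ X}
    (h : ∀ a b c, ap f (tmul (tmul a b) c) = ap g (tmul (tmul a b) c)) : f = g := by
  refine tensor_hom_ext_inl_inr (tensor_hom_ext fun a b => ?_) (hom_ext fun c => ?_)
  · simpa using h a b 1
  · simpa [tmul_one_one] using h 1 1 c

/-- The symmetry. -/
def braidHom (A B : VNAlg.{u}) : tensor A B ⟶ tensor B A := (exists_braid A B).choose

@[simp] theorem braidHom_tmul (a : A.Elt) (b : B.Elt) : ap (braidHom A B) (tmul a b) = tmul b a :=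
  (exists_braid A B).choose_spec a b

theorem braidHom_braidHom (A B : VNAlg.{u}) : braidHom A B ≫ braidHom B A = 𝟙 _ :=
  tensor_hom_ext fun a b => by simp

/-- The associator. -/
def assocHom (A B C : VNAlg.{u}) : tensor (tensor A B) C ⟶ tensor A (tensor B C) :=
  (exists_assoc A B C).choose

@[simp] theorem assocHom_tmul (a : A.Elt) (b : B.Elt) (c : C.Elt) :
    ap (assocHom A B C) (tmul (tmul a b) c) = tmul a (tmul b c) :=
  (exists_assoc A B C).choose_spec a b c

/-- The inverse of the associator. -/
def assocInv (A B C : VNAlg.{u}) : tensor A (tensor B C) ⟶ tensor (tensor A B) C :=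
  -- Cyclic rotation: `a ⊗ (b ⊗ c)`, `(b ⊗ c) ⊗ a`, `b ⊗ (c ⊗ a)`, `(c ⊗ a) ⊗ b`, `c ⊗ (a ⊗ b)`, `(a
  -- ⊗ b) ⊗ c`.
  braidHom _ _ ≫ assocHom B C A ≫ braidHom _ _ ≫ assocHom C A B ≫ braidHom _ _

@[simp] theorem assocInv_tmul (a : A.Elt) (b : B.Elt) (c : C.Elt) :
    ap (assocInv A B C) (tmul a (tmul b c)) = tmul (tmul a b) c := by
  simp [assocInv]

/-- The left unitor. -/
def lidHom (A : VNAlg.{u}) : tensor unit A ⟶ A := (exists_lid A).choose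

@[simp] theorem lidHom_tmul (z : ℂ) (a : A.Elt) :
    ap (lidHom A) (tmul (algebraMap ℂ unit.Elt z) a) = z • a := (exists_lid A).choose_spec z a

@[simp] theorem lidHom_one_tmul (a : A.Elt) : ap (lidHom A) (tmul 1 a) = a := by
  simpa using lidHom_tmul 1 a

/-- The left unitor as an isomorphism. -/
def lidIso (A : VNAlg.{u}) : tensor unit A ≅ A where
  hom := lidHom A
  inv := inr unit A
  hom_inv_id := tensor_hom_ext_inl_inr unit_hom_ext (hom_ext fun a => by simp)
  inv_hom_id := hom_ext fun a => by simp

/-- The symmetry as an isomorphism. -/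
def braidIso (A B : VNAlg.{u}) : tensor A B ≅ tensor B A where
  hom := braidHom A B
  inv := braidHom B A
  hom_inv_id := braidHom_braidHom A B
  inv_hom_id := braidHom_braidHom B A

/-- The structure morphisms of the spatial tensor product. -/
def spatialTensorData : SpatialTensorData.{u} where
  map f g := (exists_map f g).choose
  map_tmul f g := (exists_map f g).choose_spec
  assoc A B C :=
    { hom := assocHom A B C
      inv := assocInv A B C
      hom_inv_id := tensor_hom_ext_assoc fun a b c => by simp
      inv_hom_id := by
        refine tensor_hom_ext_inl_inr (hom_ext fun a => ?_) (tensor_hom_ext fun b c => ?_)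
        -- Splitting the unit as `1 ⊗ 1` makes `a ⊗ 1` an elementary tensor of three factors.
        · simp [← tmul_one_one]
        · simp }
  assoc_tmul := assocHom_tmul
  lid := lidIso
  lid_tmul := lidHom_tmul
  rid A := braidIso A unit ≪≫ lidIso A
  rid_tmul a z := (congrArg (ap (lidHom _)) (braidHom_tmul _ _)).trans (lidHom_tmul z a)
  braid := braidIso
  braid_tmul := braidHom_tmul

namespace SpatialTensorData

variable (T : SpatialTensorData.{u})

attribute [simp] map_tmul assoc_tmul lid_tmul rid_tmul braid_tmul

@[simp] theorem assoc_inv_tmul (a : A.Elt) (b : B.Elt) (c : C.Elt) :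
    ap (T.assoc A B C).inv (tmul a (tmul b c)) = tmul (tmul a b) c := by
  rw [← T.assoc_tmul, ← ap_comp, Iso.hom_inv_id, ap_id]

@[simp] theorem lid_one_tmul (a : A.Elt) : ap (T.lid A).hom (tmul 1 a) = a := by
  simpa using T.lid_tmul 1 a

@[simp] theorem rid_tmul_one (a : A.Elt) : ap (T.rid A).hom (tmul a 1) = a := by
  simpa using T.rid_tmul a 1

/-- The axioms of a symmetric monoidal category hold since morphisms are determined by their
values on elementary tensors. -/
def toSpatialTensor : SpatialTensor.{u} where
  toSpatialTensorData := T
  map_id A B := tensor_hom_ext fun a b => by simp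
  map_comp f₁ f₂ g₁ g₂ := tensor_hom_ext fun a b => by simp
  assoc_naturality f₁ f₂ f₃ := tensor_hom_ext_assoc fun a b c => by simp
  lid_naturality f := tensor_hom_ext_inl_inr unit_hom_ext (hom_ext fun a => by simp)
  rid_naturality f := tensor_hom_ext_inl_inr (hom_ext fun a => by simp) unit_hom_ext
  pentagon A B C D := by
    refine tensor_hom_ext_inl_inr (tensor_hom_ext_assoc fun a b c => ?_) (hom_ext fun d => ?_)
    · simp
    · simp [← tmul_one_one]
  triangle A B := by
    refine tensor_hom_ext_inl_inr (tensor_hom_ext_inl_inr (hom_ext fun a => ?_) unit_hom_ext)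
      (hom_ext fun b => ?_)
    · simp
    · simp [← tmul_one_one]
  braid_naturality f g := tensor_hom_ext fun a b => by simp
  hexagon_forward A B C := tensor_hom_ext_assoc fun a b c => by simp
  hexagon_reverse A B C := by
    refine tensor_hom_ext_inl_inr (hom_ext fun a => ?_) (tensor_hom_ext fun b c => ?_)
    · simp [← tmul_one_one]
    · simp
  symmetry A B := tensor_hom_ext fun a b => by simp

end SpatialTensorData

theorem nonempty_spatialTensor : Nonempty SpatialTensor.{u} :=
  ⟨spatialTensorData.toSpatialTensor⟩

end VNAlg

section

/-! ### Products of `ℓ^∞`-algebras -/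

open VNAlg

variable {X Y : Type u}

open Classical in
/-- The standard basis of `ℓ²(X)`. -/
def basisVec (x : X) : (ellInfty X).H := (lp.single 2 x 1 : EllTwo X)

theorem inner_basisVec (x : X) (f : EllTwo X) :
    ⟪basisVec x, (show (ellInfty X).H from f)⟫_ℂ = f x := by
  classical
  have : ⟪(lp.single 2 x 1 : EllTwo X), f⟫_ℂ = f x := by
    simp [lp.inner_single_left]
  exact this

theorem inner_basisVec_self (x : X) : ⟪basisVec x, basisVec x⟫_ℂ = 1 := by
  classical
  exact (inner_basisVec x _).trans (lp.single_apply_self _ _ _)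

theorem ellInftyEval_equiv (φ : BddFun X) (x : X) : ellInftyEval x (ellInftyEquiv X φ) = φ x := by
  change (ellInftyEquiv X).symm (ellInftyEquiv X φ) x = φ x
  rw [StarAlgEquiv.symm_apply_apply]

theorem inner_basisVec_apply (t : (ellInfty X).Elt) (f : (ellInfty X).H) (x : X) :
    ⟪basisVec x, t.1 f⟫_ℂ = ellInftyEval x t * ⟪basisVec x, f⟫_ℂ := by
  obtain ⟨φ, rfl⟩ : ∃ φ, ellInftyEquiv X φ = t := (ellInftyEquiv X).surjective t
  rw [ellInftyEval_equiv]
  exact (inner_basisVec x (mulOp φ f)).trans (congrArg (φ x * ·) (inner_basisVec x f).symm)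

theorem ellInfty_vec_ext {f g : (ellInfty X).H} (h : ∀ x, ⟪basisVec x, f⟫_ℂ = ⟪basisVec x, g⟫_ℂ) :
    f = g :=
  ellTwo_ext fun x => (inner_basisVec x f).symm.trans ((h x).trans (inner_basisVec x g))

theorem ellInfty_apply_basisVec (t : (ellInfty X).Elt) (x : X) :
    t.1 (basisVec x) = ellInftyEval x t • basisVec x := by
  classical
  refine ellInfty_vec_ext fun y => ?_
  rw [inner_basisVec_apply, inner_smul_right]
  by_cases hxy : y = x
  · rw [hxy]
  · have : ⟪basisVec y, basisVec x⟫_ℂ = 0 :=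
      (inner_basisVec y _).trans (lp.single_apply_ne _ _ _ hxy)
    rw [this, mul_zero, mul_zero]

/-- The adjoints of `S` and `T` send each vector to elements of `ℓ²(X)` with equal coordinates. -/
theorem ellInfty_op_ext {L : Type*} [NormedAddCommGroup L] [InnerProductSpace ℂ L]
    [CompleteSpace L] {S T : (ellInfty X).H →L[ℂ] L}
    (h : ∀ x, S (basisVec x) = T (basisVec x)) : S = T := by
  refine adjoint.injective (ContinuousLinearMap.ext fun v => ellInfty_vec_ext fun x => ?_)
  rw [adjoint_inner_right, adjoint_inner_right, h]

/-- The vector `e_x ⊗ e_y`. -/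
def basisPt (p : X × Y) : (tensor (ellInfty X) (ellInfty Y)).H :=
  pt (basisVec p.1) (basisVec p.2)

theorem inner_basisPt_pt (p : X × Y) (f : (ellInfty X).H) (g : (ellInfty Y).H) :
    ⟪basisPt p, pt f g⟫_ℂ = ⟪basisVec p.1, f⟫_ℂ * ⟪basisVec p.2, g⟫_ℂ := inner_pt _ _ _ _

theorem basisPt_ne_zero (p : X × Y) : basisPt p ≠ 0 := fun h => by
  have := inner_basisPt_pt p (basisVec p.1) (basisVec p.2)
  rw [h, inner_zero_left, inner_basisVec_self, inner_basisVec_self] at this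
  simp at this

theorem basisPt_op_ext {L : Type*} [NormedAddCommGroup L] [InnerProductSpace ℂ L] [CompleteSpace L]
    {S T : (tensor (ellInfty X) (ellInfty Y)).H →L[ℂ] L} (h : ∀ p, S (basisPt p) = T (basisPt p)) :
    S = T := by
  refine op_ext fun f g => ?_
  have h1 : ∀ x, S ∘L ptL (ellInfty Y) (basisVec x) = T ∘L ptL (ellInfty Y) (basisVec x) :=
    fun x => ellInfty_op_ext fun y => h (x, y)
  have h2 : S ∘L ptR (ellInfty X) g = T ∘L ptR (ellInfty X) g :=
    ellInfty_op_ext fun x => DFunLike.congr_fun (h1 x) g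
  exact DFunLike.congr_fun h2 f

theorem tmul_basisPt (a : (ellInfty X).Elt) (b : (ellInfty Y).Elt) (p : X × Y) :
    (tmul a b).1 (basisPt p) = (ellInftyEval p.1 a * ellInftyEval p.2 b) • basisPt p := by
  rw [basisPt, tmul_pt, ellInfty_apply_basisVec, ellInfty_apply_basisVec, pt_smul_left,
    pt_smul_right, smul_smul]

/-- The rank-one operators `v ↦ ⟪e_x ⊗ e_y, v⟫ e_(x,y)` are total, and they intertwine because
functions act on the basis vectors by scalars. -/
theorem exists_ellInftyMu (X Y : Type u) :
    ∃ Φ : tensor (ellInfty X) (ellInfty Y) ⟶ ellInfty (X × Y), ∀ a b p,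
      ellInftyEval p (ap Φ (tmul a b)) = ellInftyEval p.1 a * ellInftyEval p.2 b := by
  obtain ⟨Φ, hΦ, -⟩ := exists_tensor_desc (C := ellInfty (X × Y))
    (ellInftyMap Prod.fst) (ellInftyMap Prod.snd)
    (𝓧 := Set.range fun p : X × Y => (innerSL ℂ (basisPt p)).smulRight (basisVec p))
    (isTotal_of_forall_inner fun v hv => ellInfty_vec_ext fun p => by
      have := hv _ ⟨p, rfl⟩ (basisPt p)
      dsimp only at this
      rw [smulRight_apply, inner_smul_left] at this
      rw [inner_zero_right]
      exact (mul_eq_zero.1 this).resolve_left (by simpa using basisPt_ne_zero p))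
    (by
      rintro _ ⟨p, rfl⟩ a f g
      dsimp only
      rw [smulRight_apply, smulRight_apply, map_smul, innerSL_apply_apply, innerSL_apply_apply,
        ellInfty_apply_basisVec, inner_basisPt_pt, inner_basisPt_pt, inner_basisVec_apply,
        ellInftyEval_map, smul_smul]
      congr 1
      ring)
    (by
      rintro _ ⟨p, rfl⟩ a f g
      dsimp only
      rw [smulRight_apply, smulRight_apply, map_smul, innerSL_apply_apply, innerSL_apply_apply,
        ellInfty_apply_basisVec, inner_basisPt_pt, inner_basisPt_pt, inner_basisVec_apply,
        ellInftyEval_map, smul_smul]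
      congr 1
      ring)
  exact ⟨Φ, fun a b p => by rw [hΦ, map_mul, ellInftyEval_map, ellInftyEval_map]⟩

open Classical in
/-- The indicator function of a point. -/
def pointMass (x : X) : (ellInfty X).Elt := ellInftyEquiv X (lp.single ∞ x 1)

theorem ellInftyEval_pointMass_self (x : X) : ellInftyEval x (pointMass x) = 1 := by
  classical
  rw [pointMass, ellInftyEval_equiv]
  simp

theorem ellInftyEval_pointMass_ne {x y : X} (h : y ≠ x) : ellInftyEval y (pointMass x) = 0 := by
  classical
  rw [pointMass, ellInftyEval_equiv]
  exact lp.single_apply_ne _ _ _ h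

theorem star_pointMass (x : X) : star (pointMass x) = pointMass x := by
  refine ellInfty_ext fun y => ?_
  rw [map_star]
  by_cases h : y = x
  · rw [h, ellInftyEval_pointMass_self, star_one]
  · rw [ellInftyEval_pointMass_ne h, star_zero]

theorem ellInfty_mul_comm (s t : (ellInfty X).Elt) : s * t = t * s :=
  ellInfty_ext fun x => by rw [map_mul, map_mul, mul_comm]

/-- An operator commuting with all point masses is a multiplication operator, and these commute with
one another. -/
theorem generates_pointMass (X : Type u) : Generates (ellInfty X) (Set.range pointMass) := by
  intro c hc t
  obtain ⟨φ, hφ⟩ : c ∈ (mulOpHom X).range := mem_range_mulOpHom fun x => hc _ ⟨x, rfl⟩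
  have : c = (ellInftyEquiv X φ).1 := hφ.symm
  rw [this]
  exact congrArg Subtype.val (ellInfty_mul_comm (ellInftyEquiv X φ) t)

/-- The rank-one operators `e_(x,y) ↦ e_x ⊗ e_y` match the point mass at `(x, y)` with a tensor of
point masses. The images of other functions need not be elementary tensors, so the map is described
by its eigenvalues. -/
theorem exists_ellInftyMuInv (X Y : Type u) :
    ∃ Φ : ellInfty (X × Y) ⟶ tensor (ellInfty X) (ellInfty Y), ∀ t p,
      (ap Φ t).1 (basisPt p) = ellInftyEval p t • basisPt p := by
  have key : ∀ (p q : X × Y),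
      ((innerSL ℂ (basisVec q)).smulRight (basisPt q)) ∘L (pointMass p).1 =
        (tmul (pointMass p.1) (pointMass p.2)).1 ∘L
          ((innerSL ℂ (basisVec q)).smulRight (basisPt q)) := by
    intro p q
    ext f
    change ⟪basisVec q, (pointMass p).1 f⟫_ℂ • basisPt q =
      (tmul (pointMass p.1) (pointMass p.2)).1 (⟪basisVec q, f⟫_ℂ • basisPt q)
    rw [map_smul, tmul_basisPt, smul_smul, inner_basisVec_apply, mul_comm]
    congr 2
    by_cases h1 : q.1 = p.1
    · by_cases h2 : q.2 = p.2
      · rw [Prod.ext h1 h2]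
        simp [ellInftyEval_pointMass_self]
      · rw [ellInftyEval_pointMass_ne h2, ellInftyEval_pointMass_ne fun h => h2 (by rw [h]),
          mul_zero]
    · rw [ellInftyEval_pointMass_ne h1, ellInftyEval_pointMass_ne fun h => h1 (by rw [h]),
          zero_mul]
  obtain ⟨Φ, hΦ⟩ := exists_hom_of_generates (A := ellInfty (X × Y))
    (B := tensor (ellInfty X) (ellInfty Y))
    (generates_pointMass _)
    (𝓧 := Set.range fun p : X × Y => (innerSL ℂ (basisVec p)).smulRight (basisPt p))
    (isTotal_of_forall_inner fun v hv => by
      have : innerSL ℂ v = 0 := basisPt_op_ext fun p => by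
        have := hv _ ⟨p, rfl⟩ (basisVec p)
        dsimp only at this
        rw [smulRight_apply, innerSL_apply_apply, inner_basisVec_self, one_smul] at this
        simpa using inner_eq_zero_symm.1 this
      simpa using DFunLike.congr_fun this v)
    (by
      rintro _ ⟨p, rfl⟩
      refine ⟨tmul (pointMass p.1) (pointMass p.2), ?_⟩
      rintro _ ⟨q, rfl⟩
      rw [star_tmul, star_pointMass, star_pointMass, star_pointMass]
      exact ⟨key p q, key p q⟩)
  refine ⟨Φ, fun t p => ?_⟩
  have := DFunLike.congr_fun (hΦ _ ⟨p, rfl⟩ t) (basisVec p)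
  change (ap Φ t).1 (⟪basisVec p, basisVec p⟫_ℂ • basisPt p) =
    ⟪basisVec p, t.1 (basisVec p)⟫_ℂ • basisPt p at this
  rw [inner_basisVec_self, one_smul] at this
  rw [this, ellInfty_apply_basisVec, inner_smul_right, inner_basisVec_self, mul_one]

theorem ellInftyMu_comp_inv {Φ : tensor (ellInfty X) (ellInfty Y) ⟶ ellInfty (X × Y)}
    (hΦ : ∀ a b p, ellInftyEval p (ap Φ (tmul a b)) = ellInftyEval p.1 a * ellInftyEval p.2 b)
    {Ψ : ellInfty (X × Y) ⟶ tensor (ellInfty X) (ellInfty Y)}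
    (hΨ : ∀ t p, (ap Ψ t).1 (basisPt p) = ellInftyEval p t • basisPt p) :
    Φ ≫ Ψ = 𝟙 _ ∧ Ψ ≫ Φ = 𝟙 _ := by
  have h1 : Φ ≫ Ψ = 𝟙 _ := tensor_hom_ext fun a b => Subtype.ext (basisPt_op_ext fun p => by
    rw [ap_comp, hΨ, hΦ, ap_id, tmul_basisPt])
  -- The map `Ψ` is injective, since the eigenvalues of `Ψ t` are the values of `t`; so the second
  -- identity follows from the first.
  refine ⟨h1, hom_ext fun t => ellInfty_ext fun p =>
    smul_left_injective ℂ (basisPt_ne_zero p) ?_⟩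
  dsimp only
  have h2 : ap Ψ (ap (Ψ ≫ Φ) t) = ap Ψ t := by
    rw [ap_comp, ← ap_comp Φ Ψ, h1, ap_id]
  rw [← hΨ, ← hΨ, h2, ap_id]

/-- The canonical isomorphism `ℓ^∞(X) ⊗ ℓ^∞(Y) ≅ ℓ^∞(X × Y)`. -/
def ellInftyMuIso (X Y : Type u) : tensor (ellInfty X) (ellInfty Y) ≅ ellInfty (X × Y) where
  hom := (exists_ellInftyMu X Y).choose
  inv := (exists_ellInftyMuInv X Y).choose
  hom_inv_id := (ellInftyMu_comp_inv (exists_ellInftyMu X Y).choose_spec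
    (exists_ellInftyMuInv X Y).choose_spec).1
  inv_hom_id := (ellInftyMu_comp_inv (exists_ellInftyMu X Y).choose_spec
    (exists_ellInftyMuInv X Y).choose_spec).2

theorem ellInftyEval_muIso (a : (ellInfty X).Elt) (b : (ellInfty Y).Elt) (p : X × Y) :
    ellInftyEval p (ap (ellInftyMuIso X Y).hom (tmul a b)) =
      ellInftyEval p.1 a * ellInftyEval p.2 b := (exists_ellInftyMu X Y).choose_spec a b p

theorem generates_ellInfty_punit : Generates (ellInfty PUnit.{u + 1}) ∅ :=
  generates_empty fun t => ⟨ellInftyEval .unit t, ellInfty_ext fun x => by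
    cases x
    rw [AlgHomClass.commutes (ellInftyEval PUnit.unit)]
    rfl⟩

theorem exists_ellInfty_punit_hom : Nonempty (ellInfty PUnit.{u + 1} ⟶ unit) := by
  obtain ⟨Φ, -⟩ := exists_hom_of_generates (A := ellInfty PUnit) (B := unit)
    generates_ellInfty_punit
    (𝓧 := Set.range fun x : unit.H => (innerSL ℂ (basisVec PUnit.unit)).smulRight x)
    (isTotal_of_forall_inner fun v hv => by
      have := hv _ ⟨v, rfl⟩ (basisVec .unit)
      dsimp only at this
      rw [smulRight_apply, innerSL_apply_apply, inner_basisVec_self] at this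
      simpa using this) (by simp)
  exact ⟨Φ⟩

/-- The canonical isomorphism `ℂ ≅ ℓ^∞(1)`. -/
def ellInftyEpsIso : unit ≅ ellInfty PUnit.{u + 1} where
  hom := fromUnit _
  inv := exists_ellInfty_punit_hom.some
  hom_inv_id := unit_hom_ext
  inv_hom_id := hom_ext_of_generates generates_ellInfty_punit (by simp)

/-- A normal character is a morphism into `ℓ^∞` of a point, so `tensor_hom_ext` applies. -/
theorem nsp_ext_tensor {A B : VNAlg.{u}} {ω ω' : Nsp (tensor A B)}
    (h : ∀ a b, ω.1 (tmul a b) = ω'.1 (tmul a b)) : ω = ω' := by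
  have := tensor_hom_ext (f := transpose fun _ : PUnit => ω) (g := transpose fun _ : PUnit => ω')
    fun a b => ellInfty_ext fun x => by simpa using h a b
  refine Subtype.ext (StarAlgHom.ext fun t => ?_)
  have h2 := congrArg (fun f => ellInftyEval PUnit.unit (ap f t)) this
  simpa using h2

theorem nsp_unit_eq (ω ω' : Nsp unit.{u}) : ω = ω' := by
  refine Subtype.ext (StarAlgHom.ext fun t => ?_)
  obtain ⟨c, rfl⟩ := exists_eq_algebraMap t
  rw [AlgHomClass.commutes, AlgHomClass.commutes]

end

/-! ### The monoidal structures of the two functors -/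

namespace VNAlg.SpatialTensor

variable (T : SpatialTensor.{u})

section naturality

variable {X Y Z X' : Type u}

/-- Describing `h` only by its values lets it be the whiskered map in `(Type u)ᵒᵖ`. -/
theorem ellInftyMu_natural_left (f : Y → X) (X' : Type u) {h : Y × X' → X × X'}
    (hh : ∀ p, h p = (f p.1, p.2)) :
    T.map (ellInftyMap f) (𝟙 (ellInfty X')) ≫ (ellInftyMuIso Y X').hom =
      (ellInftyMuIso X X').hom ≫ ellInftyMap h := by
  refine tensor_hom_ext fun a b => ellInfty_ext fun p => ?_
  rw [ap_comp, ap_comp, T.map_tmul, ellInftyEval_muIso, ellInftyEval_map, ellInftyEval_map,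
    ellInftyEval_muIso, ap_id, hh]

theorem ellInftyMu_natural_right (X' : Type u) (f : Y → X) {h : X' × Y → X' × X}
    (hh : ∀ p, h p = (p.1, f p.2)) :
    T.map (𝟙 (ellInfty X')) (ellInftyMap f) ≫ (ellInftyMuIso X' Y).hom =
      (ellInftyMuIso X' X).hom ≫ ellInftyMap h := by
  refine tensor_hom_ext fun a b => ellInfty_ext fun p => ?_
  rw [ap_comp, ap_comp, T.map_tmul, ellInftyEval_muIso, ellInftyEval_map, ellInftyEval_map,
    ellInftyEval_muIso, ap_id, hh]

theorem ellInftyMu_assoc {h : X × (Y × Z) → (X × Y) × Z}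
    (hh : ∀ p, h p = ((p.1, p.2.1), p.2.2)) :
    T.map (ellInftyMuIso X Y).hom (𝟙 (ellInfty Z)) ≫ (ellInftyMuIso (X × Y) Z).hom ≫
      ellInftyMap h =
    (T.assoc _ _ _).hom ≫ T.map (𝟙 (ellInfty X)) (ellInftyMuIso Y Z).hom ≫
      (ellInftyMuIso X (Y × Z)).hom := by
  refine tensor_hom_ext_assoc fun a b c => ellInfty_ext fun p => ?_
  rw [ap_comp, ap_comp, ap_comp, ap_comp, T.map_tmul, T.assoc_tmul, T.map_tmul,
    ellInftyEval_muIso, ellInftyEval_map, hh, ellInftyEval_muIso, ellInftyEval_muIso,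
    ellInftyEval_muIso, ap_id, ap_id, mul_assoc]

theorem ellInftyMu_lid (X : Type u) : (T.lid (ellInfty X)).hom =
    T.map ellInftyEpsIso.hom (𝟙 (ellInfty X)) ≫ (ellInftyMuIso PUnit X).hom ≫
      ellInftyMap (Y := PUnit × X) (X := X) fun x => (.unit, x) := by
  refine tensor_hom_ext_inl_inr unit_hom_ext (hom_ext fun a => ellInfty_ext fun x => ?_)
  rw [ap_comp, ap_comp, ap_comp, ap_comp, ap_inr, T.map_tmul, T.lid_one_tmul, ellInftyEval_map,
    ellInftyEval_muIso, map_one, map_one, ap_id, one_mul]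

theorem ellInftyMu_rid (X : Type u) : (T.rid (ellInfty X)).hom =
    T.map (𝟙 (ellInfty X)) ellInftyEpsIso.hom ≫ (ellInftyMuIso X PUnit).hom ≫
      ellInftyMap (Y := X × PUnit) (X := X) fun x => (x, .unit) := by
  refine tensor_hom_ext_inl_inr (hom_ext fun a => ellInfty_ext fun x => ?_) unit_hom_ext
  rw [ap_comp, ap_comp, ap_comp, ap_comp, ap_inl, T.map_tmul, T.rid_tmul_one, ellInftyEval_map,
    ellInftyEval_muIso, map_one, map_one, ap_id, mul_one]

theorem ellInftyMu_braid (X Y : Type u) : (ellInftyMuIso X Y).hom ≫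
      ellInftyMap (Y := X × Y) (X := Y × X) (fun p => (p.2, p.1)) =
    (T.braid _ _).hom ≫ (ellInftyMuIso Y X).hom := by
  refine tensor_hom_ext fun a b => ellInfty_ext fun p => ?_
  rw [ap_comp, ap_comp, T.braid_tmul, ellInftyEval_map, ellInftyEval_muIso, ellInftyEval_muIso,
    mul_comm]

end naturality

attribute [local irreducible] VNAlg.tensor ellInfty VNAlg.unit ellInftyMuIso ellInftyMap

/-- The strong monoidal structure of `ℓ^∞`. -/
def ellInftyCoreMonoidal :
    letI : MonoidalCategory VNAlg.{u} := T.monoidalCategory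
    ellInftyFunctor.{u}.CoreMonoidal :=
  letI : MonoidalCategory VNAlg.{u} := T.monoidalCategory
  { εIso := ellInftyEpsIso
    μIso := fun X Y => ellInftyMuIso X.unop Y.unop
    μIso_hom_natural_left := fun f X' =>
      T.ellInftyMu_natural_left f.unop X'.unop fun _ => rfl
    μIso_hom_natural_right := fun X' f =>
      T.ellInftyMu_natural_right X'.unop f.unop fun _ => rfl
    associativity := fun _ _ _ => T.ellInftyMu_assoc fun _ => rfl
    left_unitality := fun X => T.ellInftyMu_lid X.unop
    right_unitality := fun X => T.ellInftyMu_rid X.unop }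

/-- The strong symmetric monoidal structure of `ℓ^∞`. -/
abbrev ellInftyBraided :
    letI : MonoidalCategory VNAlg.{u} := T.monoidalCategory
    letI : SymmetricCategory VNAlg.{u} := T.symmetricCategory
    ellInftyFunctor.{u}.Braided :=
  letI : MonoidalCategory VNAlg.{u} := T.monoidalCategory
  letI : SymmetricCategory VNAlg.{u} := T.symmetricCategory
  { T.ellInftyCoreMonoidal.toMonoidal with
    braided := fun X Y => T.ellInftyMu_braid X.unop Y.unop }

/-- The oplax monoidal structure of `nsp`, as a left adjoint of `ℓ^∞`. -/
abbrev nspOplaxMonoidal :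
    letI : MonoidalCategory VNAlg.{u} := T.monoidalCategory
    nspFunctor.{u}.OplaxMonoidal :=
  letI : MonoidalCategory VNAlg.{u} := T.monoidalCategory
  letI := T.ellInftyCoreMonoidal.toMonoidal
  nspAdjunction.leftAdjointOplaxMonoidal

/-- The unit `A ⟶ ℓ^∞(nsp A)` of the adjunction. -/
def nspUnit (A : VNAlg.{u}) : A ⟶ ellInfty (Nsp A) := nspAdjunction.unit.app A

theorem ellInftyEval_nspUnit {A : VNAlg.{u}} (ω : Nsp A) (a : A.Elt) :
    ellInftyEval ω (ap (nspUnit A) a) = ω.1 a := by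
  rw [nspUnit, ← Adjunction.homEquiv_id]
  exact ellInftyEval_nspAdjunction_homEquiv (𝟙 (Nsp A)) ω a

/-- The transported `δ` is the transpose of `μ ∘ (unit ⊗ unit)`, and the unit evaluates `a` at `ω`.
This also supplies the existence and normality of the product of two normal characters. -/
theorem nsp_δ_tmul (A B : VNAlg.{u}) (ω₁ : Nsp A) (ω₂ : Nsp B) (a : A.Elt) (b : B.Elt) :
    letI : MonoidalCategory VNAlg.{u} := T.monoidalCategory
    letI := T.nspOplaxMonoidal
    ((Functor.OplaxMonoidal.δ nspFunctor A B).unop (ω₁, ω₂)).1 (VNAlg.tmul a b) =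
      ω₁.1 a * ω₂.1 b := by
  change ellInftyEval (ω₁, ω₂) (ap (T.map (nspUnit A) (nspUnit B) ≫
    (ellInftyMuIso (Nsp A) (Nsp B)).hom) (tmul a b)) = _
  rw [ap_comp, T.map_tmul, ellInftyEval_muIso, ellInftyEval_nspUnit, ellInftyEval_nspUnit]

theorem isIso_nsp_η :
    letI : MonoidalCategory VNAlg.{u} := T.monoidalCategory
    letI := T.nspOplaxMonoidal
    IsIso (Functor.OplaxMonoidal.η nspFunctor.{u}) := by
  let : MonoidalCategory VNAlg.{u} := T.monoidalCategory
  let := T.nspOplaxMonoidal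
  rw [← isIso_unop_iff, isIso_iff_bijective]
  exact ⟨fun _ _ _ => rfl, fun ω => ⟨PUnit.unit, nsp_unit_eq _ _⟩⟩

/-- Evaluation at `a ⊗ 1` and `1 ⊗ b` recovers both factors. Conversely, multiplicativity makes
every normal character the product of its restrictions along `inl` and `inr`. -/
theorem isIso_nsp_δ (A B : VNAlg.{u}) :
    letI : MonoidalCategory VNAlg.{u} := T.monoidalCategory
    letI := T.nspOplaxMonoidal
    IsIso (Functor.OplaxMonoidal.δ nspFunctor.{u} A B) := by
  let : MonoidalCategory VNAlg.{u} := T.monoidalCategory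
  let := T.nspOplaxMonoidal
  rw [← isIso_unop_iff, isIso_iff_bijective]
  refine ⟨fun p q h => Prod.ext ?_ ?_, fun ω => ⟨(⟨ω.1.comp (ap (inl A B)), ?_⟩,
    ⟨ω.1.comp (ap (inr A B)), ?_⟩), nsp_ext_tensor fun a b => ?_⟩⟩
  · refine Subtype.ext (StarAlgHom.ext fun a => ?_)
    have := congrArg (fun ω : Nsp (tensor A B) => ω.1 (tmul a 1)) h
    have := (T.nsp_δ_tmul A B p.1 p.2 a 1).symm.trans (this.trans (T.nsp_δ_tmul A B q.1 q.2 a 1))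
    rwa [map_one, map_one, mul_one, mul_one] at this
  · refine Subtype.ext (StarAlgHom.ext fun b => ?_)
    have := congrArg (fun ω : Nsp (tensor A B) => ω.1 (tmul 1 b)) h
    have := (T.nsp_δ_tmul A B p.1 p.2 1 b).symm.trans (this.trans (T.nsp_δ_tmul A B q.1 q.2 1 b))
    rwa [map_one, map_one, one_mul, one_mul] at this
  · exact ω.2.comp (Hom.normal _)
  · exact ω.2.comp (Hom.normal _)
  · refine (T.nsp_δ_tmul A B _ _ a b).trans ?_
    change ω.1 (ap (inl A B) a) * ω.1 (ap (inr A B) b) = _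
    rw [ap_inl, ap_inr, ← map_mul, tmul_mul_tmul, mul_one, one_mul]

theorem nsp_δ_braid (A B : VNAlg.{u}) :
    letI : MonoidalCategory VNAlg.{u} := T.monoidalCategory
    letI : SymmetricCategory VNAlg.{u} := T.symmetricCategory
    letI := T.nspOplaxMonoidal
    nspFunctor.{u}.map (β_ A B).hom ≫ Functor.OplaxMonoidal.δ nspFunctor B A =
      Functor.OplaxMonoidal.δ nspFunctor A B ≫ (β_ (nspFunctor.obj A) (nspFunctor.obj B)).hom := by
  let : MonoidalCategory VNAlg.{u} := T.monoidalCategory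
  let : SymmetricCategory VNAlg.{u} := T.symmetricCategory
  let := T.nspOplaxMonoidal
  apply Quiver.Hom.unop_inj
  ext p
  refine nsp_ext_tensor fun a b => ?_
  change ((Functor.OplaxMonoidal.δ nspFunctor B A).unop (p.1, p.2)).1
      (ap (T.braid A B).hom (tmul a b)) =
    ((Functor.OplaxMonoidal.δ nspFunctor A B).unop (p.2, p.1)).1 (tmul a b)
  rw [T.braid_tmul]
  exact (T.nsp_δ_tmul B A _ _ b a).trans ((mul_comm _ _).trans (T.nsp_δ_tmul A B _ _ a b).symm)

/-- The strong symmetric monoidal structure of `nsp`. -/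
abbrev nspBraided :
    letI : MonoidalCategory VNAlg.{u} := T.monoidalCategory
    letI : SymmetricCategory VNAlg.{u} := T.symmetricCategory
    nspFunctor.{u}.Braided :=
  letI : MonoidalCategory VNAlg.{u} := T.monoidalCategory
  letI : SymmetricCategory VNAlg.{u} := T.symmetricCategory
  letI := T.nspOplaxMonoidal
  haveI := T.isIso_nsp_η
  haveI := T.isIso_nsp_δ
  { Functor.Monoidal.ofOplaxMonoidal nspFunctor.{u} with
    braided := fun A B => by
      change inv (Functor.OplaxMonoidal.δ nspFunctor A B) ≫ _ =
        _ ≫ inv (Functor.OplaxMonoidal.δ nspFunctor B A)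
      rw [IsIso.inv_comp_eq, ← Category.assoc, IsIso.eq_comp_inv]
      exact T.nsp_δ_braid A B }

end VNAlg.SpatialTensor

theorem mainTheorem9 :
    Nonempty VNAlg.SpatialTensor.{u} ∧
    ∀ T : VNAlg.SpatialTensor.{u},
      letI : MonoidalCategory VNAlg.{u} := T.monoidalCategory
      letI : SymmetricCategory VNAlg.{u} := T.symmetricCategory
      ∃ (_ : nspFunctor.{u}.Braided) (_ : ellInftyFunctor.{u}.Braided),
        NatTrans.IsMonoidal nspAdjunction.{u}.unit ∧
        NatTrans.IsMonoidal nspAdjunction.{u}.counit ∧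
        (∀ (A B : VNAlg.{u}) (ω₁ : Nsp A) (ω₂ : Nsp B) (a : A.Elt) (b : B.Elt),
          ((Functor.OplaxMonoidal.δ nspFunctor A B).unop (ω₁, ω₂)).1 (VNAlg.tmul a b) =
            ω₁.1 a * ω₂.1 b) ∧
        (∀ (X Y : Type u) (f : BddFun X) (g : BddFun Y) (x : X) (y : Y),
          ellInftyEval (x, y) (VNAlg.ap (Functor.LaxMonoidal.μ ellInftyFunctor (op X) (op Y))
            (VNAlg.tmul (ellInftyEquiv X f) (ellInftyEquiv Y g))) = f x * g y) := by
  refine ⟨VNAlg.nonempty_spatialTensor, fun T => ?_⟩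
  let : MonoidalCategory VNAlg.{u} := T.monoidalCategory
  let : SymmetricCategory VNAlg.{u} := T.symmetricCategory
  let := T.ellInftyCoreMonoidal.toMonoidal
  let := T.nspBraided
  -- Doctrinal adjunction: for the oplax structure transported from `ℓ^∞`, compatibility of unit and
  -- counit is automatic.
  have h : nspAdjunction.{u}.IsMonoidal :=
    letI := nspAdjunction.{u}.leftAdjointOplaxMonoidal
    (inferInstance : nspAdjunction.{u}.IsMonoidal)
  refine ⟨T.nspBraided, T.ellInftyBraided, ?_, ?_, T.nsp_δ_tmul, fun X Y f g x y => ?_⟩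
  · exact (inferInstance : NatTrans.IsMonoidal nspAdjunction.{u}.unit)
  · exact (inferInstance : NatTrans.IsMonoidal nspAdjunction.{u}.counit)
  · refine (ellInftyEval_muIso _ _ (x, y)).trans ?_
    rw [ellInftyEval_equiv, ellInftyEval_equiv]

end
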